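/- Let $n\ge 0$, and let $\alpha_0,\dots,\alpha_{n-1}\in\mathbb D$ and $\tau_n\in\mathbb S^1$ be functions of a real variable $t$, where $\mathbb D$ is the open unit disk and $\mathbb S^1$ the unit circle. Let $\mathrm G=\mathrm G(\alpha_0,\dots,\alpha_{n-1},\tau_n):=\mathrm G_0\mathrm G_1\cdots \mathrm G_n$ be the unitary $(n+1)\times(n+1)$ upper Hessenberg matrix with positive subdiagonal given by $$\mathrm G_j:=\operatorname{diag}(\mathrm I_j,\Theta_j,\mathrm I_{n-j-1}),\quad \Theta_j:=\begin{pmatrix}\overline{\alpha_j}&\rho_j\\ \rho_j&-\alpha_j\end{pmatrix},\quad \rho_j:=(1-|\alpha_j|^2)^{1/2}\quad(0\le j\le n-1),\qquad \mathrm G_n:=\operatorname{diag}(\mathrm I_n,\overline{\tau_n}),$$ and suppose that $\mathrm G$ is a differentiable function of $t\in\mathbb R$. Let $\zeta\in\mathbb S^1$ be fixed, let $\zeta^{1/2}$ be either of its square roots, and let $p_0\in\mathbb R\setminus\{0\}$. For $z\in\mathbb C$ and each $t$ define $$\tau_n(\zeta):=\tau_n,\qquad \tau_j(\zeta):=\frac{\overline\zeta\,\alpha_j+\tau_{j+1}(\zeta)}{\overline{\alpha_j}\,\tau_{j+1}(\zeta)+\overline\zeta}\quad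 (j=n-1,\dots,0),$$ $$\beta_0(\zeta):=\frac1{\overline{\zeta^{1/2}}-\tau_0(\zeta)\,\zeta^{1/2}},\qquad \beta_j(\zeta):=\frac1{\beta_{j-1}(\zeta)}\;\frac1{\overline\zeta+\tau_{j-1}(\zeta)\,\overline{\alpha_{j-2}}}\;\frac1{1-\overline{\tau_{j-1}(\zeta)}\,\alpha_{j-1}}\quad (j=1,\dots,n),$$ with the convention $\alpha_{-1}:=-1$; the polynomials $$p_{-1}(z,\zeta):=0,\quad p_0(z,\zeta):=p_0,\quad p_{j+1}(z,\zeta):=\bigl(\beta_j(\zeta)+\overline{\beta_j(\zeta)}\,z\bigr)p_j(z,\zeta)-z\,p_{j-1}(z,\zeta)\quad (j=0,\dots,n);$$ and the lower bidiagonal matrix $$\mathrm A:=\zeta^{1/2}\begin{pmatrix}\overline{\beta_0(\zeta)}&&&\\-1&\overline{\beta_1(\zeta)}&&\\&\ddots&\ddots&\\&&-1&\overline{\beta_n(\zeta)}\end{pmatrix},\qquad \mathrm H:=\frac{\mathrm A+\mathrm A^*}2,\quad \mathrm K:=\frac{\mathrm A-\mathrm A^*}{2i},$$ so that $\mathrm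 A=\mathrm H+i\mathrm K$. Then, at every $t$ at which $\zeta$ is not an eigenvalue of $\mathrm G$: 1. $\mathrm H$ is positive definite. 2. The eigenvalues of $\mathrm G$ coincide, also with multiplicities, with the zeros of $p_{n+1}(\cdot,\zeta)$. 3. The matrix function $\mathrm H^{-1/2}\mathrm K\mathrm H^{-1/2}$ is differentiable at $t$. For each eigenvalue $\eta$ of $\mathrm G$ at $t$ there is a real function $\theta$, defined and continuous near $t$, such that $e^{i\theta(u)}$ is an eigenvalue of $\mathrm G$ at $u$ for all $u$ near $t$ and $e^{i\theta(t)}=\eta$. Every such $\theta$ is differentiable at $t$ and, writing $\frac{\mathrm d}{\mathrm dt}\arg\eta:=\theta'(t)$ and $\mathrm p:=(p_0(\eta,\zeta),\dots,p_n(\eta,\zeta))^{\mathrm T}$, $$\Bigl(\mathrm p,\ \mathrm H^{1/2}\,\frac{\mathrm d}{\mathrm dt}\bigl(\mathrm H^{-1/2}\mathrm K\mathrm H^{-1/2}\bigr)\,\mathrm H^{1/2}\,\mathrm p\Bigr)=\frac{(\mathrm p,\mathrm H\mathrm p)}{\cos\bigl(\arg(\overline\zeta\eta)\bigr)-1}\;\frac{\mathrm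 d}{\mathrm dt}\arg\eta .$$ -/

import Mathlib

open Filter Topology
open scoped Polynomial ComplexConjugate ComplexOrder MatrixOrder

noncomputable section

namespace Hessenberg

/-- The factor `diag(I_j, Θ(a), I_{n-j-1})` of order `n+1`, where `Θ(a)` is the 2-by-2 block with
rows `(conj a, ρ)` and `(ρ, -a)`, `ρ = (1 - |a|^2)^{1/2}`, occupying the rows and columns
`j` and `j+1` (indices start from `0`). -/
def rotFactor (n j : ℕ) (a : ℂ) : Matrix (Fin (n + 1)) (Fin (n + 1)) ℂ :=
  Matrix.of fun r c =>
    if r.val = j ∧ c.val = j then conj a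
    else if r.val = j ∧ c.val = j + 1 then ((Real.sqrt (1 - ‖a‖ ^ 2) : ℝ) : ℂ)
    else if r.val = j + 1 ∧ c.val = j then ((Real.sqrt (1 - ‖a‖ ^ 2) : ℝ) : ℂ)
    else if r.val = j + 1 ∧ c.val = j + 1 then -a
    else if r = c then 1 else 0

/-- The last factor `diag(I_n, conj τ)` of order `n+1`. -/
def lastFactor (n : ℕ) (τ : ℂ) : Matrix (Fin (n + 1)) (Fin (n + 1)) ℂ :=
  Matrix.diagonal fun r => if r.val = n then conj τ else 1

/-- The matrix `G(α_0, …, α_{n-1}, τ) = G_0 G_1 ⋯ G_n`. Only `α 0, …, α (n-1)` are used. -/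
def G (n : ℕ) (α : ℕ → ℂ) (τ : ℂ) : Matrix (Fin (n + 1)) (Fin (n + 1)) ℂ :=
  ((List.range n).map fun j => rotFactor n j (α j)).prod * lastFactor n τ

/-- `z` is an eigenvalue of the matrix `M`. -/
def IsEigenvalue {m : ℕ} (M : Matrix (Fin m) (Fin m) ℂ) (z : ℂ) : Prop :=
  Module.End.HasEigenvalue (Matrix.toLin' M) z

/-- The pseudoreflexion coefficients `τ_j(ζ)`: `τ_n(ζ) = τ` and, for `j = n-1, …, 0`,
`τ_j(ζ) = (conj ζ * α_j + τ_{j+1}(ζ)) / (conj α_j * τ_{j+1}(ζ) + conj ζ)`.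
(Indices `j > n` do not occur.) -/
def pseudo (n : ℕ) (α : ℕ → ℂ) (τ ζ : ℂ) (j : ℕ) : ℂ :=
  if j < n then
    (conj ζ * α j + pseudo n α τ ζ (j + 1)) / (conj (α j) * pseudo n α τ ζ (j + 1) + conj ζ)
  else τ
termination_by n - j

/-- `prevCoeff α j` is `α_{j-1}`, with the usual convention `α_{-1} = -1`. -/
def prevCoeff (α : ℕ → ℂ) : ℕ → ℂ
  | 0 => -1
  | j + 1 => α j

/-- The numbers `β_j(ζ)`, `0 ≤ j ≤ n`; `s` is the chosen square root of `ζ`. -/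
def beta (n : ℕ) (α : ℕ → ℂ) (τ ζ s : ℂ) : ℕ → ℂ
  | 0 => 1 / (conj s - pseudo n α τ ζ 0 * s)
  | j + 1 =>
      1 / beta n α τ ζ s j
        * (1 / (conj ζ + pseudo n α τ ζ j * conj (prevCoeff α j)))
        * (1 / (1 - conj (pseudo n α τ ζ j) * α j))

/-- The polynomials `p_j(z, ζ)`: `p_0` is the constant `p₀`, and
`p_{j+1} = (β_j + conj β_j z) p_j - z p_{j-1}` with `p_{-1} = 0`. -/
def poly (n : ℕ) (α : ℕ → ℂ) (τ ζ s : ℂ) (p₀ : ℝ) : ℕ → ℂ[X]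
  | 0 => Polynomial.C (p₀ : ℂ)
  | 1 => (Polynomial.C (beta n α τ ζ s 0) + Polynomial.C (conj (beta n α τ ζ s 0)) * Polynomial.X) * Polynomial.C (p₀ : ℂ)
  | j + 2 =>
      (Polynomial.C (beta n α τ ζ s (j + 1)) + Polynomial.C (conj (beta n α τ ζ s (j + 1))) * Polynomial.X)
          * poly n α τ ζ s p₀ (j + 1)
        - Polynomial.X * poly n α τ ζ s p₀ j

/-- The lower bidiagonal matrix `A`: `s` times the matrix with diagonal
`conj β_0, …, conj β_n` and all subdiagonal entries equal to `-1`. -/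
def A (n : ℕ) (α : ℕ → ℂ) (τ ζ s : ℂ) : Matrix (Fin (n + 1)) (Fin (n + 1)) ℂ :=
  s • Matrix.of fun r c =>
    if r = c then conj (beta n α τ ζ s r.val)
    else if r.val = c.val + 1 then -1 else 0

/-- The Hermitian part `H = (A + A^*) / 2`. -/
def H (n : ℕ) (α : ℕ → ℂ) (τ ζ s : ℂ) : Matrix (Fin (n + 1)) (Fin (n + 1)) ℂ :=
  (1 / 2 : ℂ) • (A n α τ ζ s + (A n α τ ζ s).conjTranspose)

/-- The matrix `K = (A - A^*) / (2i)`, so that `A = H + iK`. -/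
def K (n : ℕ) (α : ℕ → ℂ) (τ ζ s : ℂ) : Matrix (Fin (n + 1)) (Fin (n + 1)) ℂ :=
  (1 / (2 * Complex.I)) • (A n α τ ζ s - (A n α τ ζ s).conjTranspose)

/-- `H^{1/2}`, the positive semidefinite square root. -/
def rootH (n : ℕ) (α : ℕ → ℂ) (τ ζ s : ℂ) : Matrix (Fin (n + 1)) (Fin (n + 1)) ℂ :=
  CFC.sqrt (H n α τ ζ s)

/-- `H^{-1/2} K H^{-1/2}`. -/
def cayley (n : ℕ) (α : ℕ → ℂ) (τ ζ s : ℂ) : Matrix (Fin (n + 1)) (Fin (n + 1)) ℂ :=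
  (rootH n α τ ζ s)⁻¹ * K n α τ ζ s * (rootH n α τ ζ s)⁻¹

/-- The vector `(p_0(z, ζ), …, p_n(z, ζ))`. -/
def polyVec (n : ℕ) (α : ℕ → ℂ) (τ ζ s : ℂ) (p₀ : ℝ) (z : ℂ) : Fin (n + 1) → ℂ :=
  fun j => (poly n α τ ζ s p₀ j.val).eval z

/-- The quadratic form `(x, M x)`. -/
def quadForm {m : ℕ} (M : Matrix (Fin m) (Fin m) ℂ) (x : Fin m → ℂ) : ℂ :=
  star x ⬝ᵥ (M.mulVec x)

/-- The entrywise derivative of a matrix-valued function of a real variable. -/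
def matrixDeriv {m : ℕ} (M : ℝ → Matrix (Fin m) (Fin m) ℂ) (t : ℝ) :
    Matrix (Fin m) (Fin m) ℂ :=
  Matrix.of fun i j => deriv (fun u => M u i j) t

/-- `θ` is a continuous choice of the argument of an eigenvalue of `M` near `t` that starts from
the eigenvalue `η` of `M t`. -/
def IsArgBranch {m : ℕ} (M : ℝ → Matrix (Fin m) (Fin m) ℂ) (t : ℝ) (η : ℂ) (θ : ℝ → ℝ) : Prop :=
  (∀ᶠ u in 𝓝 t, ContinuousAt θ u) ∧
    (∀ᶠ u in 𝓝 t, IsEigenvalue (M u) (Complex.exp (θ u * Complex.I))) ∧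
    Complex.exp (θ t * Complex.I) = η

end Hessenberg

end

noncomputable section

namespace Hessenberg

/-! Everything rests on the pencil `z conj ζ A + A^*`. The three-term recurrence says that it maps
the vector `p(z)` to `p_{n+1}(z)` times a multiple of the last basis vector
(`pencil_mulVec_polyVec`), and at `z = ζ` it equals `2H`. If `ζ` is not an eigenvalue of `G`, then
`τ_0 ζ ≠ 1` (`isEigenvalue_base`), all `β_j` are finite, and `2H = B^* B` with `B` bidiagonal and
invertible (`H_eq_cholesky`).

Up to nonzero factors, `p_{n+1}` is the paraorthogonal polynomial `z φ_n - conj τ φ_n^*`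
(`poly_eq_szego`). At its zeros `(φ_0, …, φ_n)` is a left eigenvector of `G`. Positivity of `H` puts
these zeros on the circle and makes them simple, so the degree count `n + 1` gives the whole
spectrum (`roots_poly_eq`).

At a zero, put `w = conj ζ z`. Then `K p = λ H p` with `λ = i(1 + w)/(w - 1)`, so `H^{1/2} p` is an
eigenvector of the Hermitian matrix `H^{-1/2} K H^{-1/2}`. First-order perturbation
(`hasDerivAt_eigenvalue`) gives `λ'`, and `λ = cot(φ/2)` for `w = e^{iφ}` gives `λ' = φ'/(cos φ -
1)`; equating the two is the formula. Branches exist because `e^{-i(n+1)θ/2} p_{n+1}(e^{iθ})` is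
real and changes sign at a simple zero (`exists_continuous_root`). -/

theorem conj_mul_self_of_norm_one {z : ℂ} (hz : ‖z‖ = 1) : conj z * z = 1 := by
  rw [Complex.conj_mul', hz]; simp

theorem ofReal_one_sub_norm_sq (a : ℂ) :
    ((1 - ‖a‖ ^ 2 : ℝ) : ℂ) = 1 - conj a * a := by
  rw [Complex.conj_mul']; push_cast; ring

theorem pseudo_of_lt {n : ℕ} {α : ℕ → ℂ} {τ ζ : ℂ} {j : ℕ} (hj : j < n) :
    pseudo n α τ ζ j = (conj ζ * α j + pseudo n α τ ζ (j + 1)) /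
      (conj (α j) * pseudo n α τ ζ (j + 1) + conj ζ) := by
  rw [pseudo, if_pos hj]

theorem pseudo_of_le {n : ℕ} {α : ℕ → ℂ} {τ ζ : ℂ} {j : ℕ} (hj : n ≤ j) :
    pseudo n α τ ζ j = τ := by
  rw [pseudo, if_neg hj.not_gt]

theorem add_ne_zero_of_norm_lt {a b : ℂ} (h : ‖a‖ < ‖b‖) : a + b ≠ 0 := by
  intro h0
  rw [eq_neg_of_add_eq_zero_left h0, norm_neg] at h
  exact lt_irrefl _ h

theorem one_sub_ne_zero_of_norm_lt {a : ℂ} (h : ‖a‖ < 1) : 1 - a ≠ 0 := by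
  intro h0
  rw [← sub_eq_zero.mp h0, norm_one] at h
  exact lt_irrefl _ h

/-- The parameters at one value of the time: the Verblunsky coefficients lie in the disk, the last
parameter, the base point `ζ` and its square root `s` on the circle. -/
structure Params (n : ℕ) (α : ℕ → ℂ) (τ ζ s : ℂ) : Prop where
  norm_coeff : ∀ j < n, ‖α j‖ < 1
  norm_last : ‖τ‖ = 1
  norm_base : ‖ζ‖ = 1
  sq_root : s ^ 2 = ζ

/-! ### Unimodularity and recursion of the pseudoreflexion coefficients. -/

section Pointwise

variable {n : ℕ} {α : ℕ → ℂ} {τ ζ s : ℂ}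

namespace Params

theorem norm_root (h : Params n α τ ζ s) : ‖s‖ = 1 := by
  have h1 : ‖s‖ ^ 2 = 1 := by rw [← norm_pow, h.sq_root, h.norm_base]
  nlinarith [norm_nonneg s]

theorem conj_root_mul (h : Params n α τ ζ s) : conj s * s = 1 :=
  conj_mul_self_of_norm_one h.norm_root

theorem conj_base_mul (h : Params n α τ ζ s) : conj ζ * ζ = 1 :=
  conj_mul_self_of_norm_one h.norm_base

theorem pseudo_den_ne_zero (h : Params n α τ ζ s) {j : ℕ} (hj : j < n) {w : ℂ} (hw : ‖w‖ = 1) :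
    conj (α j) * w + conj ζ ≠ 0 := by
  apply add_ne_zero_of_norm_lt
  simpa [hw, h.norm_base] using h.norm_coeff j hj

theorem norm_pseudo (h : Params n α τ ζ s) (j : ℕ) : ‖pseudo n α τ ζ j‖ = 1 := by
  by_cases hj : j < n
  · have ih := h.norm_pseudo (j + 1)
    rw [pseudo_of_lt hj, norm_div, div_eq_one_iff_eq
      (norm_ne_zero_iff.mpr (h.pseudo_den_ne_zero hj ih))]
    set w := pseudo n α τ ζ (j + 1)
    have hw : conj w * w = 1 := conj_mul_self_of_norm_one ih
    -- Numerator and conjugated denominator differ by the unimodular factor `conj ζ * w`.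
    have h1 : conj ζ * α j + w = conj ζ * w * conj (conj (α j) * w + conj ζ) := by
      simp only [map_add, map_mul, Complex.conj_conj]
      linear_combination (-(conj ζ * α j)) * hw - w * h.conj_base_mul
    rw [h1, norm_mul, norm_mul, Complex.norm_conj, Complex.norm_conj, ih, h.norm_base]; ring
  · rw [pseudo_of_le (not_lt.mp hj), h.norm_last]
termination_by n - j

theorem conj_pseudo_mul (h : Params n α τ ζ s) (j : ℕ) :
    conj (pseudo n α τ ζ j) * pseudo n α τ ζ j = 1 :=
  conj_mul_self_of_norm_one (h.norm_pseudo j)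

theorem pseudo_rec (h : Params n α τ ζ s) {j : ℕ} (hj : j < n) :
    pseudo n α τ ζ j * (conj (α j) * pseudo n α τ ζ (j + 1) + conj ζ) =
      conj ζ * α j + pseudo n α τ ζ (j + 1) := by
  conv_lhs => rw [pseudo_of_lt hj]
  exact div_mul_cancel₀ _ (h.pseudo_den_ne_zero hj (h.norm_pseudo _))

theorem conj_pseudo_rec (h : Params n α τ ζ s) {j : ℕ} (hj : j < n) :
    conj (pseudo n α τ ζ j) * (ζ + conj (pseudo n α τ ζ (j + 1)) * α j) =
      ζ * conj (α j) + conj (pseudo n α τ ζ (j + 1)) := by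
  have h1 := congrArg (starRingEnd ℂ) (h.pseudo_rec hj)
  simp only [map_add, map_mul, Complex.conj_conj] at h1
  linear_combination h1

theorem factor_ne_zero (h : Params n α τ ζ s) {j : ℕ} (hj : j < n) :
    1 - α j * conj (pseudo n α τ ζ j) ≠ 0 := by
  apply one_sub_ne_zero_of_norm_lt
  simpa [h.norm_pseudo] using h.norm_coeff j hj

theorem conj_factor_ne_zero (h : Params n α τ ζ s) {j : ℕ} (hj : j < n) :
    1 - conj (α j) * pseudo n α τ ζ j ≠ 0 := by
  have := (map_ne_zero (starRingEnd ℂ)).mpr (h.factor_ne_zero hj)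
  simpa using this

/-- The backward form of the recursion for the pseudoreflexion coefficients. -/
theorem base_mul_pseudo_succ (h : Params n α τ ζ s) {j : ℕ} (hj : j < n) :
    ζ * pseudo n α τ ζ (j + 1) * (1 - conj (α j) * pseudo n α τ ζ j) =
      pseudo n α τ ζ j - α j := by
  linear_combination (-ζ) * h.pseudo_rec hj + (pseudo n α τ ζ j - α j) * h.conj_base_mul

theorem factor_identity (h : Params n α τ ζ s) {j : ℕ} (hj : j < n) :
    ζ * (conj ζ + pseudo n α τ ζ (j + 1) * conj (α j)) * (1 - conj (α j) * pseudo n α τ ζ j) =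
      1 - conj (α j) * α j := by
  linear_combination conj (α j) * h.base_mul_pseudo_succ hj +
    (1 - conj (α j) * pseudo n α τ ζ j) * h.conj_base_mul

end Params

/-! ### Closed forms for the `β_j` in terms of positive numbers `m_j`. -/

/-- The ratios `m_j` of consecutive values at `ζ` of the (rotated) polynomials `p_j`. -/
def ratio (n : ℕ) (α : ℕ → ℂ) (τ ζ : ℂ) : ℕ → ℝ
  | 0 => 1
  | j + 1 => (1 - ‖α j‖ ^ 2) /
      (ratio n α τ ζ j * ‖1 - α j * conj (pseudo n α τ ζ j)‖ ^ 2)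

namespace Params

theorem one_sub_sq_pos (h : Params n α τ ζ s) {j : ℕ} (hj : j < n) : 0 < 1 - ‖α j‖ ^ 2 := by
  nlinarith [h.norm_coeff j hj, norm_nonneg (α j)]

theorem ratio_pos (h : Params n α τ ζ s) {j : ℕ} (hj : j ≤ n) : 0 < ratio n α τ ζ j := by
  induction j with
  | zero => exact one_pos
  | succ j ih =>
    have := ih (by omega)
    have := h.one_sub_sq_pos (j := j) (by omega)
    have := norm_pos_iff.mpr (h.factor_ne_zero (j := j) (by omega))
    rw [ratio]; positivity

theorem ratio_ne_zero (h : Params n α τ ζ s) {j : ℕ} (hj : j ≤ n) : (ratio n α τ ζ j : ℂ) ≠ 0 :=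
  Complex.ofReal_ne_zero.mpr (h.ratio_pos hj).ne'

theorem ratio_mul_succ (h : Params n α τ ζ s) {j : ℕ} (hj : j < n) :
    (ratio n α τ ζ (j + 1) : ℂ) * ratio n α τ ζ j *
      ((1 - α j * conj (pseudo n α τ ζ j)) * (1 - conj (α j) * pseudo n α τ ζ j)) =
      1 - conj (α j) * α j := by
  have h1 : (1 - α j * conj (pseudo n α τ ζ j)) * (1 - conj (α j) * pseudo n α τ ζ j) =
      ((‖1 - α j * conj (pseudo n α τ ζ j)‖ ^ 2 : ℝ) : ℂ) := by
    have := Complex.mul_conj' (1 - α j * conj (pseudo n α τ ζ j))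
    push_cast
    rw [← this]; simp
  rw [h1, ← ofReal_one_sub_norm_sq, ← Complex.ofReal_mul, ← Complex.ofReal_mul]
  congr 1
  have := (h.ratio_pos hj.le).ne'
  have := norm_ne_zero_iff.mpr (h.factor_ne_zero hj)
  rw [ratio]; field_simp

theorem den_zero_ne_zero (h : Params n α τ ζ s) (h0 : pseudo n α τ ζ 0 * ζ ≠ 1) :
    conj s - pseudo n α τ ζ 0 * s ≠ 0 := by
  intro h1
  apply h0
  linear_combination (-s) * h1 + h.conj_root_mul - pseudo n α τ ζ 0 * h.sq_root

theorem beta_zero_mul (h : Params n α τ ζ s) (h0 : pseudo n α τ ζ 0 * ζ ≠ 1) :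
    beta n α τ ζ s 0 * (conj s - pseudo n α τ ζ 0 * s) = 1 := by
  rw [beta]; exact one_div_mul_cancel (h.den_zero_ne_zero h0)

theorem conj_root_sq (h : Params n α τ ζ s) : conj s ^ 2 = conj ζ := by
  rw [← h.sq_root, map_pow]

/-- The recursive quotient defining `β_{j+1}` collapses to `s / (m_j (1 - α_j conj τ_j))`, because
`β_j` times one of its denominators is the positive number `m_j` up to the factor `s`. The two
identities feed each other along the induction: the first at `j` gives the second at `j`, which
gives the first at `j + 1`. -/
theorem beta_mul_ratio (h : Params n α τ ζ s) (h0 : pseudo n α τ ζ 0 * ζ ≠ 1) {j : ℕ}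
    (hj : j ≤ n) :
    beta n α τ ζ s j * s * (conj ζ + pseudo n α τ ζ j * conj (prevCoeff α j)) =
      ratio n α τ ζ j ∧
    (j < n → beta n α τ ζ s (j + 1) * (ratio n α τ ζ j * (1 - α j * conj (pseudo n α τ ζ j))) =
      s) := by
  have step : ∀ j, j < n → beta n α τ ζ s j * s *
      (conj ζ + pseudo n α τ ζ j * conj (prevCoeff α j)) = ratio n α τ ζ j →
      beta n α τ ζ s (j + 1) * (ratio n α τ ζ j * (1 - α j * conj (pseudo n α τ ζ j))) = s := by
    intro j hj hr
    have hm := h.ratio_ne_zero hj.le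
    have h1 := h.factor_ne_zero hj
    rw [← hr] at hm ⊢
    have h2 : beta n α τ ζ s j ≠ 0 := by
      rintro h2; simp [h2] at hm
    have h3 : conj ζ + pseudo n α τ ζ j * conj (prevCoeff α j) ≠ 0 := by
      rintro h3; simp [h3] at hm
    rw [beta, mul_comm (conj _) (α j)]
    field_simp
  induction j with
  | zero =>
    have hfirst : beta n α τ ζ s 0 * s * (conj ζ + pseudo n α τ ζ 0 * conj (prevCoeff α 0)) =
        ratio n α τ ζ 0 := by
      have := h.beta_zero_mul h0
      simp only [prevCoeff, ratio, map_neg, map_one]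
      push_cast
      linear_combination this + beta n α τ ζ s 0 * conj s * h.conj_root_mul -
        beta n α τ ζ s 0 * s * h.conj_root_sq
    exact ⟨hfirst, fun hj => step 0 hj hfirst⟩
  | succ j ih =>
    have hj' : j < n := hj
    have hb := (ih hj'.le).2 hj'
    have hr : beta n α τ ζ s (j + 1) * s *
        (conj ζ + pseudo n α τ ζ (j + 1) * conj (prevCoeff α (j + 1))) =
        ratio n α τ ζ (j + 1) := by
      have hm := h.ratio_ne_zero hj'.le
      have h1 := h.factor_ne_zero hj'
      have h2 := h.conj_factor_ne_zero hj'
      apply mul_right_cancel₀ (mul_ne_zero hm (mul_ne_zero h1 h2))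
      simp only [prevCoeff]
      linear_combination s * (conj ζ + pseudo n α τ ζ (j + 1) * conj (α j)) *
        (1 - conj (α j) * pseudo n α τ ζ j) * hb - h.ratio_mul_succ hj' + h.factor_identity hj' +
        (conj ζ + pseudo n α τ ζ (j + 1) * conj (α j)) *
        (1 - conj (α j) * pseudo n α τ ζ j) * h.sq_root
    exact ⟨hr, fun hj => step (j + 1) hj hr⟩

theorem beta_succ_mul (h : Params n α τ ζ s) (h0 : pseudo n α τ ζ 0 * ζ ≠ 1) {j : ℕ}
    (hj : j < n) :
    beta n α τ ζ s (j + 1) * (ratio n α τ ζ j * (1 - α j * conj (pseudo n α τ ζ j))) = s :=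
  (h.beta_mul_ratio h0 hj.le).2 hj

theorem conj_beta_succ_mul (h : Params n α τ ζ s) (h0 : pseudo n α τ ζ 0 * ζ ≠ 1) {j : ℕ}
    (hj : j < n) :
    conj (beta n α τ ζ s (j + 1)) * (ratio n α τ ζ j * (1 - conj (α j) * pseudo n α τ ζ j)) =
      conj s := by
  have := congrArg (starRingEnd ℂ) (h.beta_succ_mul h0 hj)
  simpa using this

theorem conj_beta_succ_mul_ratio (h : Params n α τ ζ s) (h0 : pseudo n α τ ζ 0 * ζ ≠ 1) {j : ℕ}
    (hj : j < n) :
    conj (beta n α τ ζ s (j + 1)) * conj s * (ζ + conj (pseudo n α τ ζ (j + 1)) * α j) =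
      ratio n α τ ζ (j + 1) := by
  have := congrArg (starRingEnd ℂ) (h.beta_mul_ratio h0 (j := j + 1) hj).1
  simpa [prevCoeff] using this

theorem beta_ne_zero (h : Params n α τ ζ s) (h0 : pseudo n α τ ζ 0 * ζ ≠ 1) {j : ℕ}
    (hj : j ≤ n) : beta n α τ ζ s j ≠ 0 := by
  intro hb
  have := (h.beta_mul_ratio h0 hj).1
  rw [hb, zero_mul, zero_mul] at this
  exact h.ratio_ne_zero hj this.symm

/-- The phase of `β_{j+1}` is fixed by `β_{j+1} / conj β_{j+1} = τ_j conj τ_{j+1}`. This is what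
lets the recurrence pass from the parameter `τ_j` to `τ_{j+1}` in `poly_eq_szego`. -/
theorem beta_succ_phase (h : Params n α τ ζ s) (h0 : pseudo n α τ ζ 0 * ζ ≠ 1) {j : ℕ}
    (hj : j < n) :
    beta n α τ ζ s (j + 1) * conj (pseudo n α τ ζ j) =
      conj (beta n α τ ζ s (j + 1)) * conj (pseudo n α τ ζ (j + 1)) := by
  have hm := h.ratio_ne_zero hj.le
  have h1 := h.factor_ne_zero hj
  have h2 := h.conj_factor_ne_zero hj
  have h3 : conj ζ * conj (pseudo n α τ ζ (j + 1)) * (1 - α j * conj (pseudo n α τ ζ j)) =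
      conj (pseudo n α τ ζ j) - conj (α j) := by
    have := congrArg (starRingEnd ℂ) (h.base_mul_pseudo_succ hj)
    simpa using this
  apply mul_right_cancel₀ (mul_ne_zero hm (mul_ne_zero h1 h2))
  linear_combination conj (pseudo n α τ ζ j) * (1 - conj (α j) * pseudo n α τ ζ j) *
      h.beta_succ_mul h0 hj -
    conj (pseudo n α τ ζ (j + 1)) * (1 - α j * conj (pseudo n α τ ζ j)) *
      h.conj_beta_succ_mul h0 hj - s * h3 - s * conj (α j) * h.conj_pseudo_mul j
    - conj (pseudo n α τ ζ (j + 1)) * (1 - α j * conj (pseudo n α τ ζ j)) *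
      (s * h.conj_root_sq - conj s * h.conj_root_mul)

theorem re_beta_zero (h : Params n α τ ζ s) (h0 : pseudo n α τ ζ 0 * ζ ≠ 1) :
    s * conj (beta n α τ ζ s 0) + conj s * beta n α τ ζ s 0 = ratio n α τ ζ 0 := by
  have h1 := h.beta_zero_mul h0
  have h2 : conj (beta n α τ ζ s 0) * (s - conj (pseudo n α τ ζ 0) * conj s) = 1 := by
    have := congrArg (starRingEnd ℂ) h1
    simpa using this
  have h3 : s - conj (pseudo n α τ ζ 0) * conj s ≠ 0 := by
    intro h3; rw [h3, mul_zero] at h2; exact zero_ne_one h2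
  apply mul_right_cancel₀ (mul_ne_zero (h.den_zero_ne_zero h0) h3)
  simp only [ratio]; push_cast
  linear_combination s * (conj s - pseudo n α τ ζ 0 * s) * h2 +
    conj s * (s - conj (pseudo n α τ ζ 0) * conj s) * h1 - (conj s * s) * h.conj_pseudo_mul 0

/-- The left side is a diagonal entry of `2H`. Its splitting into `m_{j+1}` and `1/m_j` is exactly
the diagonal of `B^* B` for the bidiagonal factor `cholesky`. -/
theorem re_beta_succ (h : Params n α τ ζ s) (h0 : pseudo n α τ ζ 0 * ζ ≠ 1) {j : ℕ}
    (hj : j < n) :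
    s * conj (beta n α τ ζ s (j + 1)) + conj s * beta n α τ ζ s (j + 1) =
      ratio n α τ ζ (j + 1) + (ratio n α τ ζ j : ℂ)⁻¹ := by
  have hm := h.ratio_ne_zero hj.le
  have h1 := h.factor_ne_zero hj
  have h2 := h.conj_factor_ne_zero hj
  apply mul_right_cancel₀ (mul_ne_zero hm (mul_ne_zero h1 h2))
  have h4 := inv_mul_cancel₀ hm
  linear_combination s * (1 - α j * conj (pseudo n α τ ζ j)) * h.conj_beta_succ_mul h0 hj +
    conj s * (1 - conj (α j) * pseudo n α τ ζ j) * h.beta_succ_mul h0 hj - h.ratio_mul_succ hj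
    + (2 - α j * conj (pseudo n α τ ζ j) - conj (α j) * pseudo n α τ ζ j) * h.conj_root_mul
    - (1 - α j * conj (pseudo n α τ ζ j)) * (1 - conj (α j) * pseudo n α τ ζ j) * h4
    - α j * conj (α j) * h.conj_pseudo_mul j

end Params

/-! ### Cholesky factorization and positivity of `H`. -/

theorem sum_ite_succ_eq (f : Fin (n + 1) → ℂ) (r : Fin (n + 1)) :
    (∑ k : Fin (n + 1), if r.val = k.val + 1 then f k else 0) =
      if 0 < r.val then f ⟨r.val - 1, by omega⟩ else 0 := by
  split_ifs with h
  · rw [Finset.sum_eq_single ⟨r.val - 1, by omega⟩]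
    · rw [if_pos (by simp; omega)]
    · intro k _ hk
      rw [if_neg]
      intro h1
      exact hk (Fin.ext (by simp; omega))
    · simp
  · exact Finset.sum_eq_zero fun k _ => if_neg (by omega)

theorem sum_ite_eq_succ (f : ℕ → ℂ) (r : Fin (n + 1)) :
    (∑ k : Fin (n + 1), if k.val = r.val + 1 then f k else 0) =
      if r.val < n then f (r.val + 1) else 0 := by
  split_ifs with h
  · rw [Finset.sum_eq_single ⟨r.val + 1, by omega⟩]
    · rw [if_pos rfl]
    · intro k _ hk
      rw [if_neg]
      intro h1
      exact hk (Fin.ext h1)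
    · simp
  · exact Finset.sum_eq_zero fun k _ => if_neg (by omega)

/-- The upper bidiagonal factor `B` of `2 H = Bᴴ B`. -/
def cholesky (n : ℕ) (α : ℕ → ℂ) (τ ζ s : ℂ) : Matrix (Fin (n + 1)) (Fin (n + 1)) ℂ :=
  Matrix.of fun r c =>
    if r = c then s * (Real.sqrt (ratio n α τ ζ r) : ℂ)
    else if c.val = r.val + 1 then -(Real.sqrt (ratio n α τ ζ r) : ℂ)⁻¹ else 0

theorem A_apply (r c : Fin (n + 1)) : A n α τ ζ s r c =
    (if r = c then s * conj (beta n α τ ζ s r) else 0) +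
      if r.val = c.val + 1 then -s else 0 := by
  simp only [A, Matrix.smul_apply, Matrix.of_apply, smul_eq_mul]
  split_ifs with h1 h2
  · subst h1; omega
  all_goals simp

namespace Params

theorem sqrt_ratio_mul_self (h : Params n α τ ζ s) {j : ℕ} (hj : j ≤ n) :
    (Real.sqrt (ratio n α τ ζ j) : ℂ) * Real.sqrt (ratio n α τ ζ j) = ratio n α τ ζ j := by
  rw [← Complex.ofReal_mul, Real.mul_self_sqrt (h.ratio_pos hj).le]

theorem sqrt_ratio_ne_zero (h : Params n α τ ζ s) {j : ℕ} (hj : j ≤ n) :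
    (Real.sqrt (ratio n α τ ζ j) : ℂ) ≠ 0 :=
  Complex.ofReal_ne_zero.mpr (Real.sqrt_pos.mpr (h.ratio_pos hj)).ne'

theorem H_eq_cholesky (h : Params n α τ ζ s) (h0 : pseudo n α τ ζ 0 * ζ ≠ 1) :
    H n α τ ζ s = (1 / 2 : ℝ) • ((cholesky n α τ ζ s).conjTranspose * cholesky n α τ ζ s) := by
  have hB : ∀ r c, cholesky n α τ ζ s r c =
      (if r = c then s * (Real.sqrt (ratio n α τ ζ r) : ℂ) else 0) +
      if c.val = r.val + 1 then -(Real.sqrt (ratio n α τ ζ r) : ℂ)⁻¹ else 0 := by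
    intro r c
    simp only [cholesky, Matrix.of_apply]
    split_ifs with h1 h2
    · subst h1; omega
    all_goals simp
  ext r c
  -- The guard `0 < r` matters: truncated subtraction would otherwise add a spurious `1/m_0` in the
  -- corner.
  have hsum : ((cholesky n α τ ζ s).conjTranspose * cholesky n α τ ζ s) r c =
      (if r = c then (ratio n α τ ζ r : ℂ) +
        (if 0 < r.val then (ratio n α τ ζ (r.val - 1) : ℂ)⁻¹ else 0) else 0) +
      (if c.val = r.val + 1 then -conj s else 0) + if r.val = c.val + 1 then -s else 0 := by
    simp only [Matrix.mul_apply, Matrix.conjTranspose_apply, hB, star_add, add_mul, mul_add,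
      Finset.sum_add_distrib, ite_mul, mul_ite, apply_ite star, star_zero, zero_mul, mul_zero,
      Finset.sum_ite_eq', Finset.mem_univ, if_true]
    rw [sum_ite_succ_eq]
    have e1 : ∀ j ≤ n, star (s * (Real.sqrt (ratio n α τ ζ j) : ℂ)) *
        (s * (Real.sqrt (ratio n α τ ζ j) : ℂ)) = ratio n α τ ζ j := by
      intro j hj
      rw [← h.sqrt_ratio_mul_self hj]
      simp only [Complex.star_def, map_mul, Complex.conj_ofReal]
      linear_combination (Real.sqrt (ratio n α τ ζ j) : ℂ) ^ 2 * h.conj_root_mul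
    have e2 : ∀ j ≤ n, star (-(Real.sqrt (ratio n α τ ζ j) : ℂ)⁻¹) *
        (s * (Real.sqrt (ratio n α τ ζ j) : ℂ)) = -s := by
      intro j hj
      have := h.sqrt_ratio_ne_zero hj
      simp only [Complex.star_def, map_neg, map_inv₀, Complex.conj_ofReal]
      field_simp
    have e3 : ∀ j ≤ n, star (s * (Real.sqrt (ratio n α τ ζ j) : ℂ)) *
        -(Real.sqrt (ratio n α τ ζ j) : ℂ)⁻¹ = -conj s := by
      intro j hj
      have := h.sqrt_ratio_ne_zero hj
      simp only [Complex.star_def, map_mul, Complex.conj_ofReal]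
      field_simp
    have e4 : ∀ j ≤ n, star (-(Real.sqrt (ratio n α τ ζ j) : ℂ)⁻¹) *
        -(Real.sqrt (ratio n α τ ζ j) : ℂ)⁻¹ = (ratio n α τ ζ j : ℂ)⁻¹ := by
      intro j hj
      rw [← h.sqrt_ratio_mul_self hj, mul_inv]
      simp only [Complex.star_def, map_neg, map_inv₀, Complex.conj_ofReal]
      ring
    rw [e1 _ (by omega), e2 _ (by omega)]
    simp only [e3 _ (show c.val - 1 ≤ n by omega), e4 _ (show c.val - 1 ≤ n by omega)]
    rcases lt_trichotomy r.val c.val with hlt | heq | hlt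
    · have hne : r ≠ c := fun h => by omega
      by_cases h1 : c.val = r.val + 1
      · have hp : (⟨c.val - 1, by omega⟩ : Fin (n + 1)) = r := Fin.ext (by simp; omega)
        simp [hne, hne.symm, h1, show ¬ r.val = r.val + 1 + 1 by omega]
      · have hp : ¬ (⟨c.val - 1, by omega⟩ : Fin (n + 1)) = r := fun h => by
          have := congrArg Fin.val h; simp at this; omega
        simp [hne, hne.symm, h1, show ¬ r.val = c.val + 1 by omega, hp,
          show ¬ r.val = c.val - 1 + 1 by omega]
    · have heq : r = c := Fin.ext heq
      subst heq
      by_cases h1 : 0 < r.val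
      · have hp : ¬ (⟨r.val - 1, by omega⟩ : Fin (n + 1)) = r := fun h => by
          have := congrArg Fin.val h; simp at this; omega
        simp [h1, hp, Nat.sub_add_cancel (show 1 ≤ r.val from h1)]
      · simp [h1]
    · have hne : r ≠ c := fun h => by omega
      have hp : ¬ (⟨c.val - 1, by omega⟩ : Fin (n + 1)) = r := fun h => by
          have := congrArg Fin.val h; simp at this; omega
      simp [hne, hne.symm, hp, show ¬ c.val = r.val + 1 by omega]
      omega
  rw [Matrix.smul_apply, hsum]
  simp only [H, Matrix.smul_apply, Matrix.add_apply, Matrix.conjTranspose_apply, A_apply,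
    Complex.real_smul, smul_eq_mul, star_add, apply_ite star, star_zero]
  push_cast
  rcases eq_or_ne r c with rfl | hne
  · obtain ⟨_ | j, hr⟩ := r
    · have := h.re_beta_zero h0
      simp
      linear_combination this
    · have := h.re_beta_succ h0 (j := j) (by omega)
      simp
      linear_combination this
  · simp [hne, hne.symm]
    ring

theorem H_posDef (h : Params n α τ ζ s) (h0 : pseudo n α τ ζ 0 * ζ ≠ 1) :
    (H n α τ ζ s).PosDef := by
  have hdet : IsUnit (cholesky n α τ ζ s).det := by
    have htri : (cholesky n α τ ζ s).BlockTriangular id := by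
      intro r c hrc
      have hrc : c.val < r.val := hrc
      simp only [cholesky, Matrix.of_apply]
      rw [if_neg (fun h => by omega), if_neg (by omega)]
    rw [Matrix.det_of_isUpperTriangular htri, isUnit_iff_ne_zero, Finset.prod_ne_zero_iff]
    intro j _
    simp only [cholesky, Matrix.of_apply, if_true]
    exact mul_ne_zero (norm_ne_zero_iff.mp (by rw [h.norm_root]; exact one_ne_zero))
      (h.sqrt_ratio_ne_zero (by omega))
  rw [h.H_eq_cholesky h0]
  refine Matrix.PosDef.smul (Matrix.PosDef.conjTranspose_mul_self _ ?_) (by norm_num)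
  exact Matrix.mulVec_injective_of_isUnit ((Matrix.isUnit_iff_isUnit_det _).mpr hdet)

end Params

/-! ### The pencil and the three-term recurrence. -/

theorem A_mulVec (f : ℕ → ℂ) (r : Fin (n + 1)) :
    (A n α τ ζ s).mulVec (fun j => f j) r =
      s * (conj (beta n α τ ζ s r) * f r - if 0 < r.val then f (r.val - 1) else 0) := by
  simp only [Matrix.mulVec, dotProduct, A_apply, add_mul, Finset.sum_add_distrib, ite_mul, zero_mul,
    Finset.sum_ite_eq, Finset.mem_univ, if_true]
  rw [sum_ite_succ_eq (fun k => -s * f k)]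
  split_ifs <;> ring

theorem A_conjTranspose_mulVec (f : ℕ → ℂ) (r : Fin (n + 1)) :
    (A n α τ ζ s).conjTranspose.mulVec (fun j => f j) r =
      conj s * (beta n α τ ζ s r * f r - if r.val < n then f (r.val + 1) else 0) := by
  simp only [Matrix.mulVec, dotProduct, Matrix.conjTranspose_apply, A_apply, star_add,
    apply_ite star, star_zero, add_mul, Finset.sum_add_distrib, ite_mul, zero_mul,
    Finset.sum_ite_eq', Finset.mem_univ, if_true]
  rw [sum_ite_eq_succ (fun k => star (-s) * f k)]
  simp only [Complex.star_def, map_mul, map_neg, Complex.conj_conj]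
  split_ifs <;> ring

/-- One recurrence for all `j`, the conditional standing for `p_{-1} = 0`; the value of `j - 1` at
`j = 0` is thus harmless. -/
theorem poly_succ (p₀ : ℝ) (j : ℕ) : poly n α τ ζ s p₀ (j + 1) =
    (Polynomial.C (beta n α τ ζ s j) + Polynomial.C (conj (beta n α τ ζ s j)) * Polynomial.X) *
      poly n α τ ζ s p₀ j -
      Polynomial.X * if 0 < j then poly n α τ ζ s p₀ (j - 1) else 0 := by
  cases j with
  | zero => simp [poly]
  | succ j => simp [poly]

theorem eval_poly_succ (p₀ : ℝ) (j : ℕ) (z : ℂ) : (poly n α τ ζ s p₀ (j + 1)).eval z =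
    (beta n α τ ζ s j + conj (beta n α τ ζ s j) * z) * (poly n α τ ζ s p₀ j).eval z -
      z * if 0 < j then (poly n α τ ζ s p₀ (j - 1)).eval z else 0 := by
  rw [poly_succ]
  split_ifs <;> simp

theorem eval_derivative_poly_succ (p₀ : ℝ) (j : ℕ) (z : ℂ) :
    (Polynomial.derivative (poly n α τ ζ s p₀ (j + 1))).eval z =
      (beta n α τ ζ s j + conj (beta n α τ ζ s j) * z) *
        (Polynomial.derivative (poly n α τ ζ s p₀ j)).eval z +
      conj (beta n α τ ζ s j) * (poly n α τ ζ s p₀ j).eval z -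
      (z * (if 0 < j then (Polynomial.derivative (poly n α τ ζ s p₀ (j - 1))).eval z
        else 0) + if 0 < j then (poly n α τ ζ s p₀ (j - 1)).eval z else 0) := by
  rw [poly_succ]
  split_ifs <;> simp <;> ring

/-- The pencil `z conj ζ A + A^*` maps the vector of the `p_j(z)` to a multiple of the last
basis vector. -/
theorem pencil_mulVec_polyVec (h : Params n α τ ζ s) (p₀ : ℝ) (z : ℂ) :
    (z * conj ζ) • (A n α τ ζ s).mulVec (polyVec n α τ ζ s p₀ z) +
      (A n α τ ζ s).conjTranspose.mulVec (polyVec n α τ ζ s p₀ z) =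
      Pi.single (Fin.last n) (conj s * (poly n α τ ζ s p₀ (n + 1)).eval z) := by
  ext r
  have hs : conj ζ * s = conj s := by
    linear_combination (-s) * h.conj_root_sq + conj s * h.conj_root_mul
  have hA := A_mulVec (n := n) (α := α) (τ := τ) (ζ := ζ) (s := s)
    (fun j => (poly n α τ ζ s p₀ j).eval z) r
  have hA' := A_conjTranspose_mulVec (n := n) (α := α) (τ := τ) (ζ := ζ) (s := s)
    (fun j => (poly n α τ ζ s p₀ j).eval z) r
  simp only [Pi.add_apply, Pi.smul_apply, smul_eq_mul]
  erw [hA, hA']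
  have hr := eval_poly_succ (n := n) (α := α) (τ := τ) (ζ := ζ) (s := s) p₀ r.val z
  -- Row `r` is `conj s` times the recurrence and cancels, except in the last row, where the term
  -- `p_{n+1}` is missing.
  by_cases hn : r.val < n
  · have hne : r ≠ Fin.last n := fun h => by rw [h] at hn; simp at hn
    rw [Pi.single_eq_of_ne hne, if_pos hn, hr]
    linear_combination z * (conj (beta n α τ ζ s r) * (poly n α τ ζ s p₀ r).eval z -
      if 0 < r.val then (poly n α τ ζ s p₀ (r.val - 1)).eval z else 0) * hs
  · have hr' : r = Fin.last n := Fin.ext (by simp; omega)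
    subst hr'
    rw [Pi.single_eq_same, if_neg hn]
    simp only [Fin.val_last] at hr ⊢
    rw [hr]
    linear_combination z * (conj (beta n α τ ζ s n) * (poly n α τ ζ s p₀ n).eval z -
      if 0 < n then (poly n α τ ζ s p₀ (n - 1)).eval z else 0) * hs

/-! ### Szegő recursion and left eigenvectors of `G`. -/

/-- `ρ = (1 - |a|^2)^{1/2}` as a complex number. -/
def rho (a : ℂ) : ℂ := (Real.sqrt (1 - ‖a‖ ^ 2) : ℝ)

theorem vecMul_rotFactor {j : ℕ} (hj : j < n) (a : ℂ) (f : ℕ → ℂ) :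
    Matrix.vecMul (fun i : Fin (n + 1) => f i) (rotFactor n j a) = fun c : Fin (n + 1) =>
      if c.val = j then f j * conj a + f (j + 1) * rho a
      else if c.val = j + 1 then f j * rho a - f (j + 1) * a else f c := by
  ext c
  simp only [Matrix.vecMul, dotProduct]
  have hne : (⟨j, by omega⟩ : Fin (n + 1)) ≠ ⟨j + 1, by omega⟩ := fun h => by simp at h
  split_ifs with h1 h2
  · rw [Fintype.sum_eq_add ⟨j, by omega⟩ ⟨j + 1, by omega⟩ hne]
    · simp [rotFactor, h1, rho]
    · rintro r ⟨hr1, hr2⟩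
      have k1 : r.val ≠ j := fun h => hr1 (Fin.ext h)
      have k2 : r.val ≠ j + 1 := fun h => hr2 (Fin.ext h)
      have k3 : r ≠ c := fun h => k1 (by rw [h, h1])
      simp [rotFactor, k1, k2, k3]
  · rw [Fintype.sum_eq_add ⟨j, by omega⟩ ⟨j + 1, by omega⟩ hne]
    · simp [rotFactor, h2, rho, sub_eq_add_neg]
    · rintro r ⟨hr1, hr2⟩
      have k1 : r.val ≠ j := fun h => hr1 (Fin.ext h)
      have k2 : r.val ≠ j + 1 := fun h => hr2 (Fin.ext h)
      have k3 : r ≠ c := fun h => k2 (by rw [h, h2])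
      simp [rotFactor, k1, k2, k3]
  · rw [Finset.sum_eq_single c]
    · simp [rotFactor, h1, h2]
    · intro r _ hr
      simp [rotFactor, h1, h2, hr]
    · simp

theorem vecMul_lastFactor (f : ℕ → ℂ) :
    Matrix.vecMul (fun i : Fin (n + 1) => f i) (lastFactor n τ) = fun c : Fin (n + 1) =>
      if c.val = n then f n * conj τ else f c := by
  ext c
  rw [lastFactor, Matrix.vecMul_diagonal]
  split_ifs with h <;> simp [h]

/-- The product `G_0 ⋯ G_{k-1}`. -/
def partialProd (n : ℕ) (α : ℕ → ℂ) (k : ℕ) : Matrix (Fin (n + 1)) (Fin (n + 1)) ℂ :=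
  ((List.range k).map fun j => rotFactor n j (α j)).prod

theorem partialProd_succ (k : ℕ) :
    partialProd n α (k + 1) = partialProd n α k * rotFactor n k (α k) := by
  simp [partialProd, List.range_succ]

theorem rho_mul_self {a : ℂ} (ha : ‖a‖ < 1) : rho a * rho a = 1 - conj a * a := by
  rw [rho, ← Complex.ofReal_mul, Real.mul_self_sqrt (by nlinarith [norm_nonneg a]),
    ofReal_one_sub_norm_sq]

theorem rho_ne_zero {a : ℂ} (ha : ‖a‖ < 1) : rho a ≠ 0 := by
  rw [rho, Complex.ofReal_ne_zero]
  exact (Real.sqrt_pos.mpr (by nlinarith [norm_nonneg a])).ne'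

/-- The orthonormal polynomials `φ_j` and their reversed polynomials, evaluated at `z`. -/
def szego (α : ℕ → ℂ) (z : ℂ) : ℕ → ℂ × ℂ
  | 0 => (1, 1)
  | j + 1 => ((z * (szego α z j).1 - conj (α j) * (szego α z j).2) / rho (α j),
      ((szego α z j).2 - α j * (z * (szego α z j).1)) / rho (α j))

theorem szego_succ_fst_mul {j : ℕ} (hj : ‖α j‖ < 1) (z : ℂ) :
    (szego α z (j + 1)).1 * rho (α j) =
      z * (szego α z j).1 - conj (α j) * (szego α z j).2 := by
  rw [szego]; exact div_mul_cancel₀ _ (rho_ne_zero hj)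

theorem szego_succ_snd_mul {j : ℕ} (hj : ‖α j‖ < 1) (z : ℂ) :
    (szego α z (j + 1)).2 * rho (α j) = (szego α z j).2 - α j * (z * (szego α z j).1) := by
  rw [szego]; exact div_mul_cancel₀ _ (rho_ne_zero hj)

/-- Each factor `G_k` performs one Szegő step on two neighbouring coordinates: it turns `(φ_k^*,
φ_{k+1})` into `(z φ_k, φ_{k+1}^*)`. The reversed polynomial is carried along at position `k`. -/
theorem szego_vecMul_partialProd (hα : ∀ j < n, ‖α j‖ < 1) (z : ℂ) {k : ℕ} (hk : k ≤ n) :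
    Matrix.vecMul (fun i : Fin (n + 1) => (szego α z i).1) (partialProd n α k) =
      fun i : Fin (n + 1) => if i.val < k then z * (szego α z i).1
        else if i.val = k then (szego α z k).2 else (szego α z i).1 := by
  induction k with
  | zero =>
    ext i
    simp only [partialProd, List.range_zero, List.map_nil, List.prod_nil, Matrix.vecMul_one,
      Nat.not_lt_zero, if_false]
    split_ifs with h
    · rw [h]; rfl
    · rfl
  | succ k ih =>
    have hk' := hα k (by omega)
    have hr := rho_ne_zero hk'
    rw [partialProd_succ, ← Matrix.vecMul_vecMul, ih (by omega),
      vecMul_rotFactor (by omega) (α k) (fun i => if i < k then z * (szego α z i).1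
        else if i = k then (szego α z k).2 else (szego α z i).1)]
    ext c
    have h1 := szego_succ_fst_mul hk' z
    have h2 := szego_succ_snd_mul hk' z
    simp only [lt_irrefl, if_false, if_true, show ¬ k + 1 < k by omega, show ¬ k + 1 = k by omega]
    rcases lt_trichotomy c.val k with hc | hc | hc
    · simp [hc, hc.ne, show ¬ c.val = k + 1 by omega, show c.val < k + 1 by omega]
    · simp only [hc, if_true, show k < k + 1 by omega]
      linear_combination h1
    · by_cases hc' : c.val = k + 1
      · simp only [hc', show ¬ k + 1 = k by omega, if_true, if_false, lt_irrefl]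
        apply mul_right_cancel₀ hr
        linear_combination (szego α z k).2 * rho_mul_self hk' - α k * h1 - h2
      · simp [hc', hc.not_gt, hc.ne', show ¬ c.val < k + 1 by omega]

theorem szego_vecMul_G (hα : ∀ j < n, ‖α j‖ < 1) {z : ℂ}
    (hz : z * (szego α z n).1 = conj τ * (szego α z n).2) :
    Matrix.vecMul (fun i : Fin (n + 1) => (szego α z i).1) (G n α τ) =
      z • fun i : Fin (n + 1) => (szego α z i).1 := by
  change Matrix.vecMul _ (partialProd n α n * lastFactor n τ) = _
  rw [← Matrix.vecMul_vecMul, szego_vecMul_partialProd hα z le_rfl,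
    vecMul_lastFactor (fun i => if i < n then z * (szego α z i).1
        else if i = n then (szego α z n).2 else (szego α z i).1)]
  ext c
  simp only [lt_irrefl, if_false, if_true, Pi.smul_apply, smul_eq_mul]
  split_ifs with h1 h2
  · rw [h1, hz, mul_comm]
  · rfl
  · omega

theorem isEigenvalue_iff_isRoot {m : ℕ} (M : Matrix (Fin m) (Fin m) ℂ) (z : ℂ) :
    IsEigenvalue M z ↔ M.charpoly.IsRoot z := by
  rw [IsEigenvalue, Module.End.hasEigenvalue_iff_isRoot_charpoly, Matrix.charpoly_toLin']

theorem isRoot_charpoly_of_vecMul {m : ℕ} {M : Matrix (Fin m) (Fin m) ℂ} {z : ℂ} {v : Fin m → ℂ}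
    (hv : v ≠ 0) (h : Matrix.vecMul v M = z • v) : M.charpoly.IsRoot z := by
  rw [Polynomial.IsRoot, Matrix.eval_charpoly, ← Matrix.exists_vecMul_eq_zero_iff]
  refine ⟨v, hv, ?_⟩
  rw [Matrix.vecMul_sub, h, sub_eq_zero]
  ext i
  simp [Matrix.scalar_apply, Matrix.vecMul_diagonal, mul_comm]

theorem isRoot_charpoly_of_szego (hα : ∀ j < n, ‖α j‖ < 1) {z : ℂ}
    (hz : z * (szego α z n).1 = conj τ * (szego α z n).2) : (G n α τ).charpoly.IsRoot z := by
  refine isRoot_charpoly_of_vecMul (fun h => ?_) (szego_vecMul_G hα hz)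
  have := congrFun h 0
  simp [szego] at this

/-! ### Zeros of `p_{n+1}` and the spectrum of `G`. -/

namespace Params

/-- Used in contrapositive form, to make the denominator of `β_0` nonzero. The relation `ζ φ_j =
conj τ_j φ_j^*` holds at `j = 0` by hypothesis and is propagated by the recursion of the `τ_j` up to
`j = n`, where it is the eigenvector condition. -/
theorem isEigenvalue_base (h : Params n α τ ζ s) (h0 : pseudo n α τ ζ 0 * ζ = 1) :
    IsEigenvalue (G n α τ) ζ := by
  have key : ∀ j ≤ n, ζ * (szego α ζ j).1 = conj (pseudo n α τ ζ j) * (szego α ζ j).2 := by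
    intro j hj
    induction j with
    | zero =>
      simp only [szego, mul_one]
      linear_combination conj (pseudo n α τ ζ 0) * h0 - ζ * h.conj_pseudo_mul 0
    | succ j ih =>
      have ih := ih (by omega)
      have hj' : j < n := hj
      have h1 := szego_succ_fst_mul (h.norm_coeff j hj') ζ
      have h2 := szego_succ_snd_mul (h.norm_coeff j hj') ζ
      apply mul_right_cancel₀ (rho_ne_zero (h.norm_coeff j hj'))
      linear_combination ζ * h1 - conj (pseudo n α τ ζ (j + 1)) * h2 +
        (ζ + conj (pseudo n α τ ζ (j + 1)) * α j) * ih + (szego α ζ j).2 * h.conj_pseudo_rec hj'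
  rw [isEigenvalue_iff_isRoot]
  apply isRoot_charpoly_of_szego h.norm_coeff
  rw [key n le_rfl, pseudo_of_le le_rfl]

/-- The constant `c` must be common to both identities: the recurrence for `p_{j+2}` combines
`p_{j+1}` and `p_j`, and both have to be known in terms of the same pair `φ_j, φ_j^*`. -/
theorem poly_eq_szego (h : Params n α τ ζ s) (h0 : pseudo n α τ ζ 0 * ζ ≠ 1) {p₀ : ℝ}
    (hp : p₀ ≠ 0) (z : ℂ) {j : ℕ} (hj : j ≤ n) : ∃ c : ℂ, c ≠ 0 ∧
    (poly n α τ ζ s p₀ j).eval z * ratio n α τ ζ j =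
      c * (s * (szego α z j).1 - conj s * conj (pseudo n α τ ζ j) * (szego α z j).2) ∧
    (poly n α τ ζ s p₀ (j + 1)).eval z =
      c * (z * (szego α z j).1 - conj (pseudo n α τ ζ j) * (szego α z j).2) := by
  induction j with
  | zero =>
    have h2 : conj (beta n α τ ζ s 0) * (s - conj (pseudo n α τ ζ 0) * conj s) = 1 := by
      have := congrArg (starRingEnd ℂ) (h.beta_zero_mul h0)
      simpa using this
    have h3 : beta n α τ ζ s 0 = -conj (pseudo n α τ ζ 0) * conj (beta n α τ ζ s 0) := by
      apply mul_right_cancel₀ (h.den_zero_ne_zero h0)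
      linear_combination h.beta_zero_mul h0 - h2 -
        conj (beta n α τ ζ s 0) * s * h.conj_pseudo_mul 0
    refine ⟨p₀ * conj (beta n α τ ζ s 0), mul_ne_zero (by exact_mod_cast hp)
      ((map_ne_zero _).mpr (h.beta_ne_zero h0 (Nat.zero_le n))), ?_, ?_⟩
    · simp only [poly, ratio, szego, Polynomial.eval_C]
      push_cast
      linear_combination (-(p₀ : ℂ)) * h2
    · rw [eval_poly_succ]
      simp only [poly, szego, Polynomial.eval_C, lt_irrefl, if_false]
      linear_combination (p₀ : ℂ) * h3
  | succ j ih =>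
    obtain ⟨c, hc, hc1, hc2⟩ := ih (by omega)
    have hj' : j < n := hj
    have hα := h.norm_coeff j hj'
    have hm := h.ratio_ne_zero hj'.le
    have hf := h.factor_ne_zero hj'
    have hf' := h.conj_factor_ne_zero hj'
    have h1 := szego_succ_fst_mul hα z
    have h2 := szego_succ_snd_mul hα z
    have hb := h.beta_succ_mul h0 hj'
    have hb' := h.conj_beta_succ_mul h0 hj'
    have hph := h.beta_succ_phase h0 hj'
    refine ⟨c * conj (beta n α τ ζ s (j + 1)) * rho (α j), mul_ne_zero (mul_ne_zero hc
      ((map_ne_zero _).mpr (h.beta_ne_zero h0 hj))) (rho_ne_zero hα), ?_, ?_⟩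
    · rw [hc2, ← h.conj_beta_succ_mul_ratio h0 hj']
      have hs : conj s * ζ = s := by
        linear_combination (-conj s) * h.sq_root + s * h.conj_root_mul
      linear_combination c * conj (beta n α τ ζ s (j + 1)) *
        ((z * (szego α z j).1 - conj (α j) * (szego α z j).2) * hs -
          conj s * (szego α z j).2 * h.conj_pseudo_rec hj' - s * h1 +
          conj s * conj (pseudo n α τ ζ (j + 1)) * h2)
    · rw [eval_poly_succ, if_pos (Nat.succ_pos j), Nat.add_sub_cancel, hc2]
      apply mul_right_cancel₀ hm
      linear_combination c * z * (szego α z j).1 * (hb + ratio n α τ ζ j * α j * hph) +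
        c * (szego α z j).2 * (-(ratio n α τ ζ j : ℂ) * hph - z * (conj (pseudo n α τ ζ j) * hb' +
          conj (beta n α τ ζ s (j + 1)) * ratio n α τ ζ j * conj (α j) * h.conj_pseudo_mul j)) -
        ratio n α τ ζ j * c * conj (beta n α τ ζ s (j + 1)) *
          (z * h1 - conj (pseudo n α τ ζ (j + 1)) * h2) - z * hc1

theorem isRoot_charpoly_of_isRoot_poly (h : Params n α τ ζ s) (h0 : pseudo n α τ ζ 0 * ζ ≠ 1)
    {p₀ : ℝ} (hp : p₀ ≠ 0) {z : ℂ} (hz : (poly n α τ ζ s p₀ (n + 1)).IsRoot z) :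
    (G n α τ).charpoly.IsRoot z := by
  obtain ⟨c, hc, -, h2⟩ := h.poly_eq_szego h0 hp z le_rfl
  rw [Polynomial.IsRoot.def] at hz
  rw [hz, eq_comm, mul_eq_zero, or_iff_right hc, sub_eq_zero, pseudo_of_le le_rfl] at h2
  exact isRoot_charpoly_of_szego h.norm_coeff h2

theorem natDegree_poly (h : Params n α τ ζ s) (h0 : pseudo n α τ ζ 0 * ζ ≠ 1)
    {p₀ : ℝ} (hp : p₀ ≠ 0) {j : ℕ} (hj : j ≤ n + 1) :
    (poly n α τ ζ s p₀ j).natDegree = j := by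
  -- The top coefficient picks up the nonzero factor `conj β_j` at each step, since `z p_{j-1}` has
  -- degree at most `j`.
  have key : ∀ j ≤ n + 1, (∀ i, j < i → (poly n α τ ζ s p₀ j).coeff i = 0) ∧
      (poly n α τ ζ s p₀ j).coeff j ≠ 0 := by
    intro j
    induction j using Nat.strong_induction_on with
    | _ j ih =>
      intro hj
      rcases j with _ | j
      · refine ⟨fun i hi => ?_, ?_⟩
        · rw [poly, Polynomial.coeff_C, if_neg hi.ne']
        · simpa [poly] using hp
      · obtain ⟨ih1, ih2⟩ := ih j (by omega) (by omega)
        have ih3 : ∀ i, j ≤ i →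
            (if 0 < j then poly n α τ ζ s p₀ (j - 1) else 0).coeff i = 0 := by
          intro i hi
          split_ifs with hj0
          · exact (ih (j - 1) (by omega) (by omega)).1 i (by omega)
          · simp
        have hc : ∀ i, (poly n α τ ζ s p₀ (j + 1)).coeff (i + 1) =
            beta n α τ ζ s j * (poly n α τ ζ s p₀ j).coeff (i + 1) +
            conj (beta n α τ ζ s j) * (poly n α τ ζ s p₀ j).coeff i -
            (if 0 < j then poly n α τ ζ s p₀ (j - 1) else 0).coeff i := by
          intro i
          rw [poly_succ, Polynomial.coeff_sub, add_mul, Polynomial.coeff_add,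
            Polynomial.coeff_C_mul, mul_assoc, Polynomial.coeff_C_mul, Polynomial.coeff_X_mul,
            Polynomial.coeff_X_mul]
        refine ⟨fun i hi => ?_, ?_⟩
        · obtain ⟨i, rfl⟩ : ∃ k, i = k + 1 := ⟨i - 1, by omega⟩
          rw [hc, ih1 _ (by omega), ih1 _ (by omega), ih3 _ (by omega)]
          ring
        · rw [hc, ih1 _ (by omega), ih3 _ le_rfl, mul_zero, zero_add, sub_zero]
          exact mul_ne_zero ((map_ne_zero _).mpr (h.beta_ne_zero h0 (by omega))) ih2
  refine le_antisymm ?_ (Polynomial.le_natDegree_of_ne_zero (key j hj).2)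
  exact Polynomial.natDegree_le_iff_coeff_eq_zero.mpr fun i hi => (key j hj).1 i hi

theorem polyVec_ne_zero {p₀ : ℝ} (hp : p₀ ≠ 0) (z : ℂ) : polyVec n α τ ζ s p₀ z ≠ 0 := by
  intro h
  have := congrFun h 0
  simp [polyVec, poly] at this
  exact hp this

theorem A_add_conjTranspose : A n α τ ζ s + (A n α τ ζ s).conjTranspose = (2 : ℂ) • H n α τ ζ s := by
  rw [H, smul_smul]; norm_num

theorem star_dotProduct_conjTranspose_mulVec {m : Type*} [Fintype m] (M : Matrix m m ℂ)
    (x y : m → ℂ) : star x ⬝ᵥ M.conjTranspose.mulVec y = conj (star y ⬝ᵥ M.mulVec x) := by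
  rw [← Complex.star_def, Matrix.star_dotProduct, Matrix.star_mulVec, Matrix.dotProduct_mulVec,
    Matrix.conjTranspose_conjTranspose, dotProduct_comm]

theorem re_quadForm_A_pos (h : Params n α τ ζ s) (h0 : pseudo n α τ ζ 0 * ζ ≠ 1)
    {x : Fin (n + 1) → ℂ} (hx : x ≠ 0) : 0 < (star x ⬝ᵥ (A n α τ ζ s).mulVec x).re := by
  have h1 := (h.H_posDef h0).re_dotProduct_pos hx
  have h2 : star x ⬝ᵥ (A n α τ ζ s).mulVec x + conj (star x ⬝ᵥ (A n α τ ζ s).mulVec x) =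
      2 * (star x ⬝ᵥ (H n α τ ζ s).mulVec x) := by
    rw [← star_dotProduct_conjTranspose_mulVec, ← dotProduct_add, ← Matrix.add_mulVec,
      A_add_conjTranspose, Matrix.smul_mulVec, dotProduct_smul, smul_eq_mul]
  have h3 := congrArg Complex.re h2
  simp at h3 h1
  linarith

/-- Pairing the pencil equation with `p` gives `w a + conj a = 0` for `w = z conj ζ` and `a = (p, A
p)`. Since `Re a > 0`, taking norms forces `|w| = 1`. -/
theorem norm_eq_one_of_isRoot_poly (h : Params n α τ ζ s) (h0 : pseudo n α τ ζ 0 * ζ ≠ 1)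
    {p₀ : ℝ} (hp : p₀ ≠ 0) {z : ℂ} (hz : (poly n α τ ζ s p₀ (n + 1)).IsRoot z) : ‖z‖ = 1 := by
  have h1 := pencil_mulVec_polyVec h p₀ z
  rw [hz.eq_zero, mul_zero, Pi.single_zero] at h1
  have h2 := h.re_quadForm_A_pos h0
    (polyVec_ne_zero (n := n) (α := α) (τ := τ) (ζ := ζ) (s := s) hp z)
  have h3 := congrArg (fun y => star (polyVec n α τ ζ s p₀ z) ⬝ᵥ y) h1
  simp only [dotProduct_add, dotProduct_smul, dotProduct_zero, smul_eq_mul,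
    star_dotProduct_conjTranspose_mulVec] at h3
  set a := star (polyVec n α τ ζ s p₀ z) ⬝ᵥ (A n α τ ζ s).mulVec (polyVec n α τ ζ s p₀ z)
  have ha : a ≠ 0 := by rintro ha; simp [ha] at h2
  have h4 := congrArg norm (eq_neg_of_add_eq_zero_left h3)
  rw [norm_neg, norm_mul, norm_mul, Complex.norm_conj, Complex.norm_conj, h.norm_base,
    mul_one] at h4
  exact mul_right_cancel₀ (norm_ne_zero_iff.mpr ha) (by rw [h4, one_mul])

/-- Differentiated form of `pencil_mulVec_polyVec`. -/
theorem pencil_mulVec_derivative (h : Params n α τ ζ s) (p₀ : ℝ) (z : ℂ) :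
    (z * conj ζ) • (A n α τ ζ s).mulVec
        (fun j => (Polynomial.derivative (poly n α τ ζ s p₀ j)).eval z) +
      (A n α τ ζ s).conjTranspose.mulVec
        (fun j => (Polynomial.derivative (poly n α τ ζ s p₀ j)).eval z) +
      conj ζ • (A n α τ ζ s).mulVec (polyVec n α τ ζ s p₀ z) =
      Pi.single (Fin.last n)
        (conj s * (Polynomial.derivative (poly n α τ ζ s p₀ (n + 1))).eval z) := by
  ext r
  have hs : conj ζ * s = conj s := by
    linear_combination (-s) * h.conj_root_sq + conj s * h.conj_root_mul
  have hA := A_mulVec (n := n) (α := α) (τ := τ) (ζ := ζ) (s := s)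
    (fun j => (Polynomial.derivative (poly n α τ ζ s p₀ j)).eval z) r
  have hA' := A_conjTranspose_mulVec (n := n) (α := α) (τ := τ) (ζ := ζ) (s := s)
    (fun j => (Polynomial.derivative (poly n α τ ζ s p₀ j)).eval z) r
  have hA'' : (A n α τ ζ s).mulVec (polyVec n α τ ζ s p₀ z) r = _ :=
    A_mulVec (fun j => (poly n α τ ζ s p₀ j).eval z) r
  simp only [Pi.add_apply, Pi.smul_apply, smul_eq_mul]
  rw [hA, hA', hA'']
  have hr := eval_derivative_poly_succ (n := n) (α := α) (τ := τ) (ζ := ζ) (s := s) p₀ r.val z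
  by_cases hn : r.val < n
  · have hne : r ≠ Fin.last n := fun h => by rw [h] at hn; simp at hn
    rw [Pi.single_eq_of_ne hne, if_pos hn, hr]
    linear_combination (z * (conj (beta n α τ ζ s r) *
        (Polynomial.derivative (poly n α τ ζ s p₀ r)).eval z -
      if 0 < r.val then (Polynomial.derivative (poly n α τ ζ s p₀ (r.val - 1))).eval z else 0) +
      (conj (beta n α τ ζ s r) * (poly n α τ ζ s p₀ r).eval z -
      if 0 < r.val then (poly n α τ ζ s p₀ (r.val - 1)).eval z else 0)) * hs
  · have hr' : r = Fin.last n := Fin.ext (by simp; omega)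
    subst hr'
    rw [Pi.single_eq_same, if_neg hn]
    simp only [Fin.val_last] at hr ⊢
    rw [hr]
    linear_combination (z * (conj (beta n α τ ζ s n) *
        (Polynomial.derivative (poly n α τ ζ s p₀ n)).eval z -
      if 0 < n then (Polynomial.derivative (poly n α τ ζ s p₀ (n - 1))).eval z else 0) +
      (conj (beta n α τ ζ s n) * (poly n α τ ζ s p₀ n).eval z -
      if 0 < n then (poly n α τ ζ s p₀ (n - 1)).eval z else 0)) * hs

/-- For `|w| = 1` the adjoint of `w A + A^*` is `conj w` times itself, so `p` annihilates the pencil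
from the left too. If the derivative vanished, pairing the differentiated pencil equation with `p`
would leave `(p, A p) = 0`, against positivity. -/
theorem derivative_ne_zero_of_isRoot_poly (h : Params n α τ ζ s) (h0 : pseudo n α τ ζ 0 * ζ ≠ 1)
    {p₀ : ℝ} (hp : p₀ ≠ 0) {z : ℂ} (hz : (poly n α τ ζ s p₀ (n + 1)).IsRoot z) :
    (Polynomial.derivative (poly n α τ ζ s p₀ (n + 1))).eval z ≠ 0 := by
  intro hd
  have h1 := pencil_mulVec_polyVec h p₀ z
  rw [hz.eq_zero, mul_zero, Pi.single_zero] at h1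
  have h2 := h.re_quadForm_A_pos h0
    (polyVec_ne_zero (n := n) (α := α) (τ := τ) (ζ := ζ) (s := s) hp z)
  have h3 := h.pencil_mulVec_derivative p₀ z
  rw [hd, mul_zero, Pi.single_zero] at h3
  set d : Fin (n + 1) → ℂ := fun j => (Polynomial.derivative (poly n α τ ζ s p₀ j)).eval z
  set p := polyVec n α τ ζ s p₀ z
  have h4 := congrArg (fun y => star p ⬝ᵥ y) h3
  have h5 := congrArg (fun y => conj (star d ⬝ᵥ y)) h1
  simp only [dotProduct_add, dotProduct_smul, dotProduct_zero, smul_eq_mul, map_add, map_mul,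
    map_zero, ← star_dotProduct_conjTranspose_mulVec, Matrix.conjTranspose_conjTranspose,
    Complex.conj_conj] at h4 h5
  have hw : conj z * z = 1 := conj_mul_self_of_norm_one (h.norm_eq_one_of_isRoot_poly h0 hp hz)
  have h6 : conj ζ * (star p ⬝ᵥ (A n α τ ζ s).mulVec p) = 0 := by
    linear_combination h4 - z * conj ζ * h5 +
      (conj ζ * ζ * (star p ⬝ᵥ (A n α τ ζ s).conjTranspose.mulVec d)) * hw +
      (star p ⬝ᵥ (A n α τ ζ s).conjTranspose.mulVec d) * h.conj_base_mul
  have h7 : star p ⬝ᵥ (A n α τ ζ s).mulVec p = 0 := by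
    linear_combination ζ * h6 - (star p ⬝ᵥ (A n α τ ζ s).mulVec p) * h.conj_base_mul
  rw [h7] at h2
  simp at h2

theorem roots_poly_eq (h : Params n α τ ζ s) (h0 : pseudo n α τ ζ 0 * ζ ≠ 1)
    {p₀ : ℝ} (hp : p₀ ≠ 0) :
    (poly n α τ ζ s p₀ (n + 1)).roots = (G n α τ).charpoly.roots := by
  have hdeg := h.natDegree_poly h0 hp (le_refl (n + 1))
  have hne : poly n α τ ζ s p₀ (n + 1) ≠ 0 := by
    intro h; rw [h] at hdeg; simp at hdeg
  have hne' : (G n α τ).charpoly ≠ 0 := (Matrix.charpoly_monic _).ne_zero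
  have hnodup : (poly n α τ ζ s p₀ (n + 1)).roots.Nodup := by
    rw [Multiset.nodup_iff_count_le_one]
    intro z
    rw [Polynomial.count_roots]
    by_contra hlt
    obtain ⟨h1, h2⟩ := (Polynomial.one_lt_rootMultiplicity_iff_isRoot hne).mp (not_le.mp hlt)
    exact h.derivative_ne_zero_of_isRoot_poly h0 hp h1 h2
  -- Simple zeros make inclusion of sets an inclusion of multisets; both multisets have `n + 1`
  -- elements.
  apply Multiset.eq_of_le_of_card_le
  · rw [Multiset.le_iff_subset hnodup]
    intro z hz
    rw [Polynomial.mem_roots hne] at hz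
    rw [Polynomial.mem_roots hne']
    exact h.isRoot_charpoly_of_isRoot_poly h0 hp hz
  · calc _ ≤ (G n α τ).charpoly.natDegree := Polynomial.card_roots' _
      _ = n + 1 := by rw [Matrix.charpoly_natDegree_eq_dim, Fintype.card_fin]
      _ = _ := hdeg.symm.trans
        (IsAlgClosed.splits (poly n α τ ζ s p₀ (n + 1))).natDegree_eq_card_roots

theorem isEigenvalue_iff (h : Params n α τ ζ s) (h0 : pseudo n α τ ζ 0 * ζ ≠ 1)
    {p₀ : ℝ} (hp : p₀ ≠ 0) (z : ℂ) :
    IsEigenvalue (G n α τ) z ↔ (poly n α τ ζ s p₀ (n + 1)).IsRoot z := by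
  have hdeg := h.natDegree_poly h0 hp (le_refl (n + 1))
  have hne : poly n α τ ζ s p₀ (n + 1) ≠ 0 := by
    intro h; rw [h] at hdeg; simp at hdeg
  rw [isEigenvalue_iff_isRoot, ← Polynomial.mem_roots (Matrix.charpoly_monic _).ne_zero,
    ← h.roots_poly_eq h0 hp, Polynomial.mem_roots hne]

end Params

end Pointwise

/-! ### Differentiability of the matrix square root. -/

section SquareRoot
open scoped Matrix.Norms.L2Operator

/-- The trace of `X^* (R X + X R)` is a sum of two nonnegative traces, so `X^* R X = 0`, and
positivity of `R` gives `X = 0`. -/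
theorem eq_zero_of_sylvester {m : ℕ} {R X : Matrix (Fin m) (Fin m) ℂ} (hR : R.PosDef)
    (h : R * X + X * R = 0) : X = 0 := by
  have h1 := hR.posSemidef.conjTranspose_mul_mul_same X
  have h2 := hR.posSemidef.mul_mul_conjTranspose_same X
  have h3 : (X.conjTranspose * R * X).trace + (X * R * X.conjTranspose).trace = 0 := by
    rw [Matrix.trace_mul_comm (X * R), ← Matrix.trace_add, Matrix.mul_assoc, ← Matrix.mul_add, h,
      Matrix.mul_zero, Matrix.trace_zero]
  have h4 : (X.conjTranspose * R * X).trace = 0 :=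
    ((add_eq_zero_iff_of_nonneg h1.trace_nonneg h2.trace_nonneg).mp h3).1
  rw [h1.trace_eq_zero_iff] at h4
  have h5 : ∀ x, X.mulVec x = 0 := by
    intro x
    by_contra hx
    have h6 := hR.dotProduct_mulVec_pos hx
    rw [Matrix.star_mulVec, ← Matrix.dotProduct_mulVec, Matrix.mulVec_mulVec, Matrix.mulVec_mulVec,
      h4] at h6
    simp at h6
  ext i j
  have := congrFun (h5 (Pi.single j 1)) i
  simpa using this

/-- Inverse function theorem for `X ↦ X * X` at `R`, whose derivative `X ↦ R X + X R` is injective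
by `eq_zero_of_sylvester`. -/
theorem differentiableAt_sqrt {m : ℕ} {M : ℝ → Matrix (Fin m) (Fin m) ℂ} {t : ℝ}
    (hM : DifferentiableAt ℝ M t) (hpos : ∀ᶠ u in 𝓝 t, (M u).PosDef) :
    DifferentiableAt ℝ (fun u => CFC.sqrt (M u)) t := by
  have hM0 := hpos.self_of_nhds
  set R := CFC.sqrt (M t) with hRdef
  have hR : R.PosDef := by
    rw [← Matrix.isStrictlyPositive_iff_posDef]
    exact IsStrictlyPositive.sqrt _ (Matrix.isStrictlyPositive_iff_posDef.mpr hM0)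
  -- Continuity keeps the positive root near `R`, where it must agree with the local inverse.
  have hcont : ContinuousAt (fun u => CFC.sqrt (M u)) t := by
    have h1 := (CFC.continuousOn_sqrt (A := Matrix (Fin m) (Fin m) ℂ)) (M t)
      hM0.posSemidef.nonneg
    refine h1.tendsto.comp ?_
    refine tendsto_nhdsWithin_iff.mpr ⟨hM.continuousAt, ?_⟩
    filter_upwards [hpos] with u hu
    exact hu.posSemidef.nonneg
  let L : Matrix (Fin m) (Fin m) ℂ →ₗ[ℝ] Matrix (Fin m) (Fin m) ℂ :=
    LinearMap.mulLeft ℝ R + LinearMap.mulRight ℝ R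
  have hL : Function.Injective L := by
    rw [← LinearMap.ker_eq_bot, LinearMap.ker_eq_bot']
    intro X hX
    exact eq_zero_of_sylvester hR hX
  let e := (LinearEquiv.ofInjectiveEndo L hL).toContinuousLinearEquiv
  have hstrict : HasStrictFDerivAt (fun X : Matrix (Fin m) (Fin m) ℂ => X * X)
      (e : Matrix (Fin m) (Fin m) ℂ →L[ℝ] Matrix (Fin m) (Fin m) ℂ) R := by
    have h1 := (hasStrictFDerivAt_id (𝕜 := ℝ) R).mul' (hasStrictFDerivAt_id (𝕜 := ℝ) R)
    refine h1.congr_fderiv ?_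
    ext1 X
    rfl
  have hg := hstrict.to_localInverse.hasFDerivAt.differentiableAt
  have hRR : R * R = M t := CFC.sqrt_mul_sqrt_self _ hM0.posSemidef.nonneg
  rw [hRR] at hg
  refine (hg.comp t hM).congr_of_eventuallyEq ?_
  filter_upwards [hpos, hcont.eventually hstrict.eventually_left_inverse] with u hu hu'
  rw [CFC.sqrt_mul_sqrt_self (M u) hu.posSemidef.nonneg] at hu'
  exact hu'.symm

theorem differentiableAt_of_entries {m : ℕ} {M : ℝ → Matrix (Fin m) (Fin m) ℂ} {t : ℝ}
    (h : ∀ i j, DifferentiableAt ℝ (fun u => M u i j) t) : DifferentiableAt ℝ M t := by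
  have h1 : M = fun u => ∑ i, ∑ j, M u i j • Matrix.single i j (1 : ℂ) := by
    ext1 u
    conv_lhs => rw [Matrix.matrix_eq_sum_single (M u)]
    simp [Matrix.smul_single]
  rw [h1]
  fun_prop

theorem differentiableAt_entry {m : ℕ} {M : ℝ → Matrix (Fin m) (Fin m) ℂ} {t : ℝ}
    (h : DifferentiableAt ℝ M t) (i j : Fin m) : DifferentiableAt ℝ (fun u => M u i j) t :=
  ((Matrix.entryLinearMap ℝ ℂ i j).toContinuousLinearMap.differentiableAt).comp t h

theorem differentiableAt_sandwich {m : ℕ} {R M : ℝ → Matrix (Fin m) (Fin m) ℂ} {t : ℝ}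
    (hR : DifferentiableAt ℝ R t) (hM : DifferentiableAt ℝ M t) (hunit : IsUnit (R t)) :
    DifferentiableAt ℝ (fun u => (R u)⁻¹ * M u * (R u)⁻¹) t := by
  have hinv : DifferentiableAt ℝ (fun u => (R u)⁻¹) t := by
    simp only [Matrix.nonsing_inv_eq_ringInverse]
    exact (differentiableAt_inverse hunit).comp t hR
  exact (hinv.mul hM).mul hinv

end SquareRoot

/-- The eigenvector need only be continuous and `lam` is not assumed differentiable. As `x t` is
also a left eigenvector of `C t`, one has `(x t, (C u - C t) x u) = (lam u - lam t) (x t, x u)`;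
divide by `u - t` and let `u → t`. -/
theorem hasDerivAt_eigenvalue {m : ℕ} {C : ℝ → Matrix (Fin m) (Fin m) ℂ}
    {C' : Matrix (Fin m) (Fin m) ℂ} {x : ℝ → Fin m → ℂ} {lam : ℝ → ℂ} {t : ℝ}
    (hC : ∀ i j, HasDerivAt (fun u => C u i j) (C' i j) t) (hherm : (C t).IsHermitian)
    (hx : ContinuousAt x t) (hx0 : x t ≠ 0)
    (hev : ∀ᶠ u in 𝓝 t, (C u).mulVec (x u) = lam u • x u) (hreal : conj (lam t) = lam t) :
    HasDerivAt lam ((star (x t) ⬝ᵥ C'.mulVec (x t)) / (star (x t) ⬝ᵥ x t)) t := by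
  have hleft : ∀ y, star (x t) ⬝ᵥ (C t).mulVec y = lam t * (star (x t) ⬝ᵥ y) := by
    intro y
    have h1 := congrArg star hev.self_of_nhds
    rw [Matrix.star_mulVec, hherm.eq, star_smul] at h1
    rw [Matrix.dotProduct_mulVec, h1, smul_dotProduct, smul_eq_mul, Complex.star_def, hreal]
  have hne : star (x t) ⬝ᵥ x t ≠ 0 := fun h => hx0 (dotProduct_star_self_eq_zero.mp h)
  have hxi : ∀ i, Tendsto (fun u => x u i) (𝓝 t) (𝓝 (x t i)) :=
    fun i => ((continuous_apply i).continuousAt.comp hx).tendsto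
  have hden : Tendsto (fun u => star (x t) ⬝ᵥ x u) (𝓝 t) (𝓝 (star (x t) ⬝ᵥ x t)) :=
    tendsto_finsetSum _ fun i _ => (hxi i).const_mul _
  rw [hasDerivAt_iff_tendsto_slope]
  have hnum : Tendsto (fun u => star (x t) ⬝ᵥ
      (Matrix.of fun i j => slope (fun v => C v i j) t u).mulVec (x u)) (𝓝[≠] t)
      (𝓝 (star (x t) ⬝ᵥ C'.mulVec (x t))) := by
    refine tendsto_finsetSum _ fun i _ => Tendsto.const_mul _ ?_
    simp only [Matrix.mulVec, dotProduct, Matrix.of_apply]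
    refine tendsto_finsetSum _ fun j _ => ?_
    exact (hasDerivAt_iff_tendsto_slope.mp (hC i j)).mul ((hxi j).mono_left nhdsWithin_le_nhds)
  refine (hnum.div (hden.mono_left nhdsWithin_le_nhds) hne).congr' ?_
  filter_upwards [nhdsWithin_le_nhds hev, nhdsWithin_le_nhds (hden.eventually_ne hne)]
    with u hu hu'
  rw [Pi.div_apply, div_eq_iff hu']
  have h1 : (Matrix.of fun i j => slope (fun v => C v i j) t u) = (u - t)⁻¹ • (C u - C t) := by
    ext i j
    simp [slope]
  rw [h1, Matrix.smul_mulVec, dotProduct_smul, Matrix.sub_mulVec, dotProduct_sub, hu, hleft,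
    dotProduct_smul, slope, smul_eq_mul, vsub_eq_sub, ← sub_mul, smul_mul_assoc]

/-! ### Recovering the coefficients from the first row of `G`. -/

theorem vecMul_partialProd_single (α : ℕ → ℂ) {n k : ℕ} (hk : k ≤ n) :
    Matrix.vecMul (fun i : Fin (n + 1) => if i.val = 0 then 1 else 0) (partialProd n α k) =
      fun i : Fin (n + 1) => if i.val < k then (∏ l ∈ Finset.range i, rho (α l)) * conj (α i)
        else if i.val = k then ∏ l ∈ Finset.range k, rho (α l) else 0 := by
  induction k with
  | zero => simp [partialProd]
  | succ k ih =>
    rw [partialProd_succ, ← Matrix.vecMul_vecMul, ih (by omega),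
      vecMul_rotFactor (by omega) (α k) (fun i => if i < k then
        (∏ l ∈ Finset.range i, rho (α l)) * conj (α i)
        else if i = k then ∏ l ∈ Finset.range k, rho (α l) else 0)]
    ext c
    simp only [lt_irrefl, if_false, if_true, show ¬ k + 1 < k by omega, show ¬ k + 1 = k by omega]
    rcases lt_trichotomy c.val k with hc | hc | hc
    · simp [hc, hc.ne, show ¬ c.val = k + 1 by omega, show c.val < k + 1 by omega]
    · simp [hc]
    · by_cases hc' : c.val = k + 1
      · simp [hc', Finset.prod_range_succ]
      · simp [hc', hc.not_gt, hc.ne', show ¬ c.val < k + 1 by omega]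

theorem G_zero_apply (n : ℕ) (α : ℕ → ℂ) (τ : ℂ) (c : Fin (n + 1)) :
    G n α τ 0 c = (∏ l ∈ Finset.range c, rho (α l)) * conj (if c.val < n then α c else τ) := by
  have h1 : G n α τ 0 c = Matrix.vecMul (fun i : Fin (n + 1) => if i.val = 0 then 1 else 0)
      (G n α τ) c := by
    simp only [Matrix.vecMul, dotProduct, ite_mul, one_mul, zero_mul]
    rw [Finset.sum_eq_single 0]
    · simp
    · intro i _ hi
      exact if_neg (fun h => hi (Fin.ext h))
    · simp
  rw [h1]
  change Matrix.vecMul _ (partialProd n α n * lastFactor n τ) c = _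
  rw [← Matrix.vecMul_vecMul, vecMul_partialProd_single α le_rfl,
    vecMul_lastFactor (fun i => if i < n then
        (∏ l ∈ Finset.range i, rho (α l)) * conj (α i)
        else if i = n then ∏ l ∈ Finset.range n, rho (α l) else 0)]
  simp only [lt_irrefl, if_false, if_true]
  split_ifs with h2 h3 h4
  · omega
  · rw [h2]
  · rfl
  · omega

theorem differentiableAt_conj {f : ℝ → ℂ} {t : ℝ} (hf : DifferentiableAt ℝ f t) :
    DifferentiableAt ℝ (fun u => conj (f u)) t := hf.star

theorem differentiableAt_rho {f : ℝ → ℂ} {t : ℝ} (hf : DifferentiableAt ℝ f t)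
    (h1 : ‖f t‖ < 1) : DifferentiableAt ℝ (fun u => rho (f u)) t := by
  unfold rho
  have h2 : DifferentiableAt ℝ (fun u => Real.sqrt (1 - ‖f u‖ ^ 2)) t :=
    ((hf.norm_sq ℝ).const_sub 1).sqrt (by nlinarith [norm_nonneg (f t)])
  exact Complex.ofRealCLM.differentiableAt.comp t h2

/-- Entry `j` of the first row of `G` is `ρ_0 ⋯ ρ_{j-1}` times `conj α_j` (or `conj τ` for `j = n`),
so the coefficients are recovered one after another by division. -/
theorem differentiableAt_coeff {n : ℕ} {α : ℝ → ℕ → ℂ} {τ : ℝ → ℂ} {t : ℝ}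
    (hα : ∀ j < n, ‖α t j‖ < 1)
    (hG : ∀ i j, DifferentiableAt ℝ (fun u => G n (α u) (τ u) i j) t) {j : ℕ} (hj : j ≤ n) :
    DifferentiableAt ℝ (fun u => if j < n then α u j else τ u) t := by
  induction j using Nat.strong_induction_on with
  | _ j ih =>
    have hrho : ∀ l ∈ Finset.range j, DifferentiableAt ℝ (fun u => rho (α u l)) t := by
      intro l hl
      have hl := Finset.mem_range.mp hl
      have h1 := ih l hl (by omega)
      simp only [show l < n by omega, if_true] at h1
      exact differentiableAt_rho h1 (hα l (by omega))
    have hprod : DifferentiableAt ℝ (fun u => ∏ l ∈ Finset.range j, rho (α u l)) t := by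
      have := DifferentiableAt.finsetProd hrho
      simpa [Finset.prod_fn] using this
    have hne : ∏ l ∈ Finset.range j, rho (α t l) ≠ 0 := by
      refine Finset.prod_ne_zero_iff.mpr fun l hl => rho_ne_zero (hα l ?_)
      have := Finset.mem_range.mp hl
      omega
    have h1 := hG 0 ⟨j, by omega⟩
    have h2 := differentiableAt_conj (h1.div hprod hne)
    refine h2.congr_of_eventuallyEq ?_
    filter_upwards [hprod.continuousAt.eventually_ne hne] with u hu
    rw [Pi.div_apply, G_zero_apply, mul_div_cancel_left₀ _ hu, Complex.conj_conj]

/-! ### Differentiability in time of `β_j`, `A`, `H`, `K` and the Cayley matrix. -/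

section Families

variable {n : ℕ} {α : ℝ → ℕ → ℂ} {τ : ℝ → ℂ} {ζ s : ℂ} {t : ℝ}

theorem differentiableAt_pseudo (hP : Params n (α t) (τ t) ζ s)
    (hα : ∀ j < n, DifferentiableAt ℝ (fun u => α u j) t) (hτ : DifferentiableAt ℝ τ t) (j : ℕ) :
    DifferentiableAt ℝ (fun u => pseudo n (α u) (τ u) ζ j) t := by
  by_cases hj : j < n
  · have ih := differentiableAt_pseudo hP hα hτ (j + 1)
    have h1 : (fun u => pseudo n (α u) (τ u) ζ j) = fun u =>
        (conj ζ * α u j + pseudo n (α u) (τ u) ζ (j + 1)) /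
        (conj (α u j) * pseudo n (α u) (τ u) ζ (j + 1) + conj ζ) :=
      funext fun u => pseudo_of_lt hj
    rw [h1]
    exact (((hα j hj).const_mul _).add ih).div
      (((differentiableAt_conj (hα j hj)).mul ih).add_const _)
      (hP.pseudo_den_ne_zero hj (hP.norm_pseudo _))
  · have h1 : (fun u => pseudo n (α u) (τ u) ζ j) = τ :=
      funext fun u => pseudo_of_le (not_lt.mp hj)
    rwa [h1]
termination_by n - j

theorem differentiableAt_beta (hP : Params n (α t) (τ t) ζ s)
    (h0 : pseudo n (α t) (τ t) ζ 0 * ζ ≠ 1)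
    (hα : ∀ j < n, DifferentiableAt ℝ (fun u => α u j) t) (hτ : DifferentiableAt ℝ τ t) {j : ℕ}
    (hj : j ≤ n) : DifferentiableAt ℝ (fun u => beta n (α u) (τ u) ζ s j) t := by
  have hps := differentiableAt_pseudo hP hα hτ
  induction j with
  | zero =>
    simp only [beta]
    exact (differentiableAt_const _).div (((hps 0).mul_const s).const_sub _)
      (hP.den_zero_ne_zero h0)
  | succ j ih =>
    have ih := ih (by omega)
    have hprev : DifferentiableAt ℝ (fun u => prevCoeff (α u) j) t := by
      cases j with
      | zero => exact differentiableAt_const _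
      | succ j => exact hα j (by omega)
    simp only [beta]
    refine (((differentiableAt_const _).div ih (hP.beta_ne_zero h0 (by omega))).mul
      ((differentiableAt_const _).div (((hps j).mul (differentiableAt_conj hprev)).const_add _)
        fun h => ?_)).mul
      ((differentiableAt_const _).div (((differentiableAt_conj (hps j)).mul
        (hα j (by omega))).const_sub _) fun h => ?_)
    · have := (hP.beta_mul_ratio h0 (j := j) (by omega)).1
      have h : conj ζ + pseudo n (α t) (τ t) ζ j * conj (prevCoeff (α t) j) = 0 := h
      rw [h, mul_zero] at this
      exact hP.ratio_ne_zero (by omega) this.symm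
    · exact hP.factor_ne_zero (j := j) (by omega) (by rw [mul_comm]; exact h)

theorem differentiableAt_A
    (hβ : ∀ j ≤ n, DifferentiableAt ℝ (fun u => beta n (α u) (τ u) ζ s j) t)
    (i j : Fin (n + 1)) : DifferentiableAt ℝ (fun u => A n (α u) (τ u) ζ s i j) t := by
  simp only [A_apply]
  refine DifferentiableAt.add ?_ (differentiableAt_const _)
  split_ifs
  · exact (differentiableAt_conj (hβ i (by omega))).const_mul _
  · exact differentiableAt_const _

theorem differentiableAt_H
    (hβ : ∀ j ≤ n, DifferentiableAt ℝ (fun u => beta n (α u) (τ u) ζ s j) t)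
    (i j : Fin (n + 1)) : DifferentiableAt ℝ (fun u => H n (α u) (τ u) ζ s i j) t := by
  simp only [H, Matrix.smul_apply, Matrix.add_apply, Matrix.conjTranspose_apply, smul_eq_mul]
  exact ((differentiableAt_A hβ i j).add
    (differentiableAt_conj (differentiableAt_A hβ j i))).const_mul _

theorem differentiableAt_K
    (hβ : ∀ j ≤ n, DifferentiableAt ℝ (fun u => beta n (α u) (τ u) ζ s j) t)
    (i j : Fin (n + 1)) : DifferentiableAt ℝ (fun u => K n (α u) (τ u) ζ s i j) t := by
  simp only [K, Matrix.smul_apply, Matrix.sub_apply, Matrix.conjTranspose_apply, smul_eq_mul]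
  exact ((differentiableAt_A hβ i j).sub
    (differentiableAt_conj (differentiableAt_A hβ j i))).const_mul _

theorem rootH_posDef {α : ℕ → ℂ} {τ : ℂ} (hH : (H n α τ ζ s).PosDef) :
    (rootH n α τ ζ s).PosDef := by
  rw [← Matrix.isStrictlyPositive_iff_posDef]
  exact IsStrictlyPositive.sqrt _ (Matrix.isStrictlyPositive_iff_posDef.mpr hH)

theorem rootH_mul_self {α : ℕ → ℂ} {τ : ℂ} (hH : (H n α τ ζ s).PosDef) :
    rootH n α τ ζ s * rootH n α τ ζ s = H n α τ ζ s :=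
  CFC.sqrt_mul_sqrt_self _ hH.posSemidef.nonneg

section Norm
open scoped Matrix.Norms.L2Operator

theorem differentiableAt_rootH
    (hβ : ∀ j ≤ n, DifferentiableAt ℝ (fun u => beta n (α u) (τ u) ζ s j) t)
    (hH : ∀ᶠ u in 𝓝 t, (H n (α u) (τ u) ζ s).PosDef) :
    DifferentiableAt ℝ (fun u => rootH n (α u) (τ u) ζ s) t :=
  differentiableAt_sqrt (differentiableAt_of_entries (differentiableAt_H hβ)) hH

theorem differentiableAt_rootH_apply
    (hβ : ∀ j ≤ n, DifferentiableAt ℝ (fun u => beta n (α u) (τ u) ζ s j) t)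
    (hH : ∀ᶠ u in 𝓝 t, (H n (α u) (τ u) ζ s).PosDef) (i j : Fin (n + 1)) :
    DifferentiableAt ℝ (fun u => rootH n (α u) (τ u) ζ s i j) t :=
  differentiableAt_entry (differentiableAt_rootH hβ hH) i j

theorem differentiableAt_cayley
    (hβ : ∀ j ≤ n, DifferentiableAt ℝ (fun u => beta n (α u) (τ u) ζ s j) t)
    (hH : ∀ᶠ u in 𝓝 t, (H n (α u) (τ u) ζ s).PosDef) (i j : Fin (n + 1)) :
    DifferentiableAt ℝ (fun u => cayley n (α u) (τ u) ζ s i j) t :=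
  differentiableAt_entry (differentiableAt_sandwich (differentiableAt_rootH hβ hH)
    (differentiableAt_of_entries (differentiableAt_K hβ))
    (rootH_posDef hH.self_of_nhds).isUnit) i j

end Norm
end Families

/-! ### Continuity of the polynomials; the general space `X` serves both time alone and the pair of
time and angle. -/

section Continuity

variable {n : ℕ} {ζ s : ℂ} {X : Type*} [TopologicalSpace X] {α : X → ℕ → ℂ} {τ z : X → ℂ} {x : X}

theorem continuousAt_eval_poly
    (hβ : ∀ j ≤ n, ContinuousAt (fun u => beta n (α u) (τ u) ζ s j) x) (hz : ContinuousAt z x)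
    (p₀ : ℝ) {j : ℕ} (hj : j ≤ n + 1) :
    ContinuousAt (fun u => (poly n (α u) (τ u) ζ s p₀ j).eval (z u)) x := by
  induction j using Nat.strong_induction_on with
  | _ j ih =>
    rcases j with _ | j
    · simp only [poly, Polynomial.eval_C]
      exact continuousAt_const
    · simp only [eval_poly_succ]
      have h1 := hβ j (by omega)
      have h2 : ContinuousAt (fun u => if 0 < j then
          (poly n (α u) (τ u) ζ s p₀ (j - 1)).eval (z u) else 0) x := by
        split_ifs
        · exact ih (j - 1) (by omega) (by omega)
        · exact continuousAt_const
      exact ((h1.add ((Complex.continuous_conj.continuousAt.comp h1).mul hz)).mul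
        (ih j (by omega) (by omega))).sub (hz.mul h2)

theorem continuousAt_eval_derivative_poly
    (hβ : ∀ j ≤ n, ContinuousAt (fun u => beta n (α u) (τ u) ζ s j) x) (hz : ContinuousAt z x)
    (p₀ : ℝ) {j : ℕ} (hj : j ≤ n + 1) :
    ContinuousAt (fun u => (Polynomial.derivative (poly n (α u) (τ u) ζ s p₀ j)).eval (z u)) x := by
  induction j using Nat.strong_induction_on with
  | _ j ih =>
    rcases j with _ | j
    · simp only [poly, Polynomial.derivative_C, Polynomial.eval_zero]
      exact continuousAt_const
    · simp only [eval_derivative_poly_succ]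
      have h1 := hβ j (by omega)
      have hc := Complex.continuous_conj.continuousAt.comp h1
      have h2 : ContinuousAt (fun u => if 0 < j then
          (poly n (α u) (τ u) ζ s p₀ (j - 1)).eval (z u) else 0) x := by
        split_ifs
        · exact continuousAt_eval_poly hβ hz p₀ (by omega)
        · exact continuousAt_const
      have h3 : ContinuousAt (fun u => if 0 < j then
          (Polynomial.derivative (poly n (α u) (τ u) ζ s p₀ (j - 1))).eval (z u) else 0) x := by
        split_ifs
        · exact ih (j - 1) (by omega) (by omega)
        · exact continuousAt_const
      exact (((h1.add (hc.mul hz)).mul (ih j (by omega) (by omega))).add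
        (hc.mul (continuousAt_eval_poly hβ hz p₀ (by omega)))).sub ((hz.mul h3).add h2)

end Continuity

/-! ### Cayley transform of the spectrum. -/

/-- The eigenvalue of the Cayley transform that corresponds to the eigenvalue `ζ w`. -/
def cayleyValue (w : ℂ) : ℂ := Complex.I * (1 + w) / (w - 1)

theorem conj_cayleyValue {w : ℂ} (hw : ‖w‖ = 1) (h1 : w ≠ 1) :
    conj (cayleyValue w) = cayleyValue w := by
  have h2 : w - 1 ≠ 0 := sub_ne_zero.mpr h1
  have h3 : conj w - 1 ≠ 0 := by
    have := (map_ne_zero (starRingEnd ℂ)).mpr h2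
    simpa using this
  simp only [cayleyValue, map_div₀, map_mul, Complex.conj_I, map_add, map_sub, map_one]
  rw [div_eq_div_iff h3 h2]
  linear_combination (-2 * Complex.I) * conj_mul_self_of_norm_one hw

section Eigenvector

variable {n : ℕ} {α : ℕ → ℂ} {τ ζ s : ℂ}

namespace Params

/-- At `z = ζ` the pencil is `2H`, which kills no nonzero vector. -/
theorem ne_one_of_isRoot (h : Params n α τ ζ s) (h0 : pseudo n α τ ζ 0 * ζ ≠ 1)
    {p₀ : ℝ} (hp : p₀ ≠ 0) {z : ℂ} (hz : (poly n α τ ζ s p₀ (n + 1)).IsRoot z) :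
    conj ζ * z ≠ 1 := by
  intro hw
  have h1 := pencil_mulVec_polyVec h p₀ z
  rw [hz.eq_zero, mul_zero, Pi.single_zero, mul_comm z, hw, one_smul, ← Matrix.add_mulVec,
    A_add_conjTranspose, Matrix.smul_mulVec, smul_eq_zero] at h1
  have h2 := (h.H_posDef h0).dotProduct_mulVec_pos
    (polyVec_ne_zero (n := n) (α := α) (τ := τ) (ζ := ζ) (s := s) hp z)
  rw [h1.resolve_left two_ne_zero, dotProduct_zero] at h2
  exact lt_irrefl _ h2

/-- From `A^* p = -w A p` one gets `2 H p = (1 - w) A p` and `2i K p = (1 + w) A p`. -/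
theorem K_mulVec_polyVec (h : Params n α τ ζ s) (h0 : pseudo n α τ ζ 0 * ζ ≠ 1)
    {p₀ : ℝ} (hp : p₀ ≠ 0) {z : ℂ} (hz : (poly n α τ ζ s p₀ (n + 1)).IsRoot z) :
    (K n α τ ζ s).mulVec (polyVec n α τ ζ s p₀ z) =
      cayleyValue (conj ζ * z) • (H n α τ ζ s).mulVec (polyVec n α τ ζ s p₀ z) := by
  have h1 := pencil_mulVec_polyVec h p₀ z
  have hw := sub_ne_zero.mpr (h.ne_one_of_isRoot h0 hp hz)
  rw [hz.eq_zero, mul_zero, Pi.single_zero, mul_comm z] at h1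
  rw [K, H, Matrix.smul_mulVec, Matrix.smul_mulVec, Matrix.add_mulVec, Matrix.sub_mulVec,
    eq_neg_of_add_eq_zero_right h1]
  ext i
  simp only [Pi.smul_apply, Pi.sub_apply, Pi.add_apply, Pi.neg_apply, smul_eq_mul, cayleyValue]
  have hI := Complex.I_ne_zero
  field_simp
  linear_combination (conj ζ * z - 1) * (1 + conj ζ * z) *
    (A n α τ ζ s).mulVec (polyVec n α τ ζ s p₀ z) i * Complex.I_sq

theorem cayley_mulVec (h : Params n α τ ζ s) (h0 : pseudo n α τ ζ 0 * ζ ≠ 1)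
    {p₀ : ℝ} (hp : p₀ ≠ 0) {z : ℂ} (hz : (poly n α τ ζ s p₀ (n + 1)).IsRoot z) :
    (cayley n α τ ζ s).mulVec ((rootH n α τ ζ s).mulVec (polyVec n α τ ζ s p₀ z)) =
      cayleyValue (conj ζ * z) • (rootH n α τ ζ s).mulVec (polyVec n α τ ζ s p₀ z) := by
  have hR := (Matrix.isUnit_iff_isUnit_det _).mp (rootH_posDef (h.H_posDef h0)).isUnit
  rw [cayley, Matrix.mulVec_mulVec, Matrix.mul_assoc, Matrix.nonsing_inv_mul _ hR, Matrix.mul_one,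
    ← Matrix.mulVec_mulVec, h.K_mulVec_polyVec h0 hp hz, ← rootH_mul_self (h.H_posDef h0),
    Matrix.mulVec_smul, Matrix.mulVec_mulVec, ← Matrix.mul_assoc, Matrix.nonsing_inv_mul _ hR,
    Matrix.one_mul]

theorem cayley_isHermitian (h : Params n α τ ζ s) (h0 : pseudo n α τ ζ 0 * ζ ≠ 1) :
    (cayley n α τ ζ s).IsHermitian := by
  have hR := (rootH_posDef (h.H_posDef h0)).isHermitian
  have hK : (K n α τ ζ s).IsHermitian := by
    rw [Matrix.IsHermitian, K, Matrix.conjTranspose_smul, Matrix.conjTranspose_sub,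
      Matrix.conjTranspose_conjTranspose, ← neg_sub (A n α τ ζ s), smul_neg, ← neg_smul]
    congr 1
    simp
  rw [Matrix.IsHermitian, cayley, Matrix.conjTranspose_mul, Matrix.conjTranspose_mul,
    Matrix.conjTranspose_nonsing_inv, hR.eq, hK.eq, Matrix.mul_assoc]

end Params
end Eigenvector

/-- By continuity `θ u` stays within `π` of `θ t`, so the principal logarithm of `f u / f t`
recovers the difference. -/
theorem differentiableAt_argument {θ : ℝ → ℝ} {f : ℝ → ℂ} {t : ℝ} (hθ : ContinuousAt θ t)
    (hf : DifferentiableAt ℝ f t) (h : ∀ᶠ u in 𝓝 t, Complex.exp (θ u * Complex.I) = f u) :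
    DifferentiableAt ℝ θ t := by
  have hne : f t ≠ 0 := by rw [← h.self_of_nhds]; exact Complex.exp_ne_zero _
  have h1 : DifferentiableAt ℝ (fun u => f u / f t) t := hf.div_const _
  have h2 : DifferentiableAt ℝ (fun u => Complex.log (f u / f t)) t :=
    (h1.hasDerivAt.clog_real
      (by rw [div_self hne]; exact Complex.one_mem_slitPlane)).differentiableAt
  have h3 : DifferentiableAt ℝ (fun u => θ t + (Complex.log (f u / f t)).im) t :=
    ((Complex.imCLM.differentiableAt).comp t h2).const_add _
  refine h3.congr_of_eventuallyEq ?_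
  have h4 : ∀ᶠ u in 𝓝 t, |θ u - θ t| < Real.pi := by
    have := (Metric.continuousAt_iff'.mp hθ) Real.pi Real.pi_pos
    simpa [Real.dist_eq] using this
  filter_upwards [h, h4] with u hu hu4
  rw [← hu, ← h.self_of_nhds, ← Complex.exp_sub, ← sub_mul, ← Complex.ofReal_sub]
  have h5 := abs_lt.mp hu4
  rw [Complex.log_exp (by simpa using h5.1) (by simpa using h5.2.le)]
  simp

theorem inv_cayleyValue {w : ℂ} (hw : w ≠ 1) :
    cayleyValue w - Complex.I ≠ 0 ∧
      w = (cayleyValue w + Complex.I) / (cayleyValue w - Complex.I) := by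
  have h1 : w - 1 ≠ 0 := sub_ne_zero.mpr hw
  have h2 : cayleyValue w - Complex.I = 2 * Complex.I / (w - 1) := by
    rw [cayleyValue]; field_simp; ring
  have h3 : cayleyValue w + Complex.I = 2 * Complex.I * w / (w - 1) := by
    rw [cayleyValue]; field_simp; ring
  have hI := Complex.I_ne_zero
  refine ⟨?_, ?_⟩
  · rw [h2]; exact div_ne_zero (mul_ne_zero two_ne_zero hI) h1
  · rw [h2, h3]; field_simp

theorem cos_arg_of_norm_one {w : ℂ} (hw : ‖w‖ = 1) : Real.cos (Complex.arg w) = w.re := by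
  rw [Complex.cos_arg (norm_ne_zero_iff.mp (by rw [hw]; exact one_ne_zero)), hw, div_one]

/-- If `w` moves on the unit circle with angular velocity `θ'`, its Cayley value has the velocity
`θ' / (Re w - 1)`. -/
theorem hasDerivAt_cayleyValue {w : ℝ → ℂ} {t θ' : ℝ} (hw : ‖w t‖ = 1) (hne : w t ≠ 1)
    (h : HasDerivAt w (w t * (θ' * Complex.I)) t) :
    HasDerivAt (fun u => cayleyValue (w u)) (θ' / (((w t).re - 1 : ℝ) : ℂ)) t := by
  have h1 : w t - 1 ≠ 0 := sub_ne_zero.mpr hne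
  have hd := ((h.const_add 1).const_mul Complex.I).div (h.sub_const 1) h1
  refine hd.congr_deriv ?_
  -- On the circle `2 w Re w = w^2 + 1`, which turns the quotient-rule denominator `(w - 1)^2` into
  -- a multiple of `Re w - 1`.
  have hre : (((w t).re - 1 : ℝ) : ℂ) * (2 * w t) = (w t - 1) ^ 2 := by
    have h2 := Complex.add_conj (w t)
    push_cast at h2 ⊢
    linear_combination (-w t) * h2 + conj_mul_self_of_norm_one hw
  have h3 : (((w t).re - 1 : ℝ) : ℂ) ≠ 0 := by
    intro h3
    rw [h3, zero_mul, eq_comm] at hre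
    exact h1 (pow_eq_zero_iff two_ne_zero |>.mp hre)
  rw [div_eq_div_iff (pow_ne_zero 2 h1) h3, ← hre]
  linear_combination (-2 * w t * θ' * (((w t).re - 1 : ℝ) : ℂ)) * Complex.I_sq

/-! ### Continuous branches of eigenvalue arguments. -/

/-- No differentiability in time is needed: since `D` is positive near `(t, θ₀)`, all `F u` with `u`
near `t` increase strictly on one common interval, and each has a unique zero there. -/
theorem exists_continuous_root {F D : ℝ → ℝ → ℝ} {t θ₀ : ℝ}
    (hF : ∀ᶠ u in 𝓝 t, ∀ θ, ContinuousAt (fun p : ℝ × ℝ => F p.1 p.2) (u, θ))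
    (hD : ∀ u θ, HasDerivAt (F u) (D u θ) θ)
    (hDc : ContinuousAt (fun p : ℝ × ℝ => D p.1 p.2) (t, θ₀)) (h0 : F t θ₀ = 0)
    (hpos : 0 < D t θ₀) :
    ∃ θ : ℝ → ℝ, (∀ᶠ u in 𝓝 t, ContinuousAt θ u) ∧ (∀ᶠ u in 𝓝 t, F u (θ u) = 0) ∧ θ t = θ₀ := by
  have h1 := hDc.eventually (lt_mem_nhds hpos)
  rw [Metric.eventually_nhds_iff] at h1
  obtain ⟨ε, hε, hball⟩ := h1
  set δ := ε / 2 with hδdef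
  have hδ : 0 < δ := by positivity
  have hmono : ∀ u, |u - t| < ε → StrictMonoOn (F u) (Set.Icc (θ₀ - δ) (θ₀ + δ)) := by
    intro u hu
    refine strictMonoOn_of_hasDerivWithinAt_pos (convex_Icc _ _)
      (fun x _ => (hD u x).continuousAt.continuousWithinAt)
      (fun x _ => (hD u x).hasDerivWithinAt) fun x hx => ?_
    rw [interior_Icc] at hx
    refine hball (y := (u, x)) ?_
    rw [Prod.dist_eq, max_lt_iff, Real.dist_eq, Real.dist_eq]
    refine ⟨hu, abs_lt.mpr ⟨?_, ?_⟩⟩ <;> linarith [hx.1, hx.2]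
  have hm0 := hmono t (by simpa using hε)
  have hslice : ∀ x, ∀ᶠ u in 𝓝 t, ContinuousAt (fun v => F v x) u := by
    intro x
    filter_upwards [hF] with u hu
    exact (hu x).comp (f := fun v : ℝ => (v, x)) (by fun_prop)
  have hneg : ∀ᶠ u in 𝓝 t, F u (θ₀ - δ) < 0 := by
    refine (hslice (θ₀ - δ)).self_of_nhds.eventually (gt_mem_nhds ?_)
    rw [← h0]
    exact hm0 ⟨le_rfl, by linarith⟩ ⟨by linarith, by linarith⟩ (by linarith)
  have hps : ∀ᶠ u in 𝓝 t, 0 < F u (θ₀ + δ) := by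
    refine (hslice (θ₀ + δ)).self_of_nhds.eventually (lt_mem_nhds ?_)
    rw [← h0]
    exact hm0 ⟨by linarith, by linarith⟩ ⟨by linarith, le_rfl⟩ (by linarith)
  have hnear : ∀ᶠ u in 𝓝 t, |u - t| < ε := by
    have := Metric.ball_mem_nhds t hε
    filter_upwards [this] with u hu
    simpa [Real.dist_eq] using hu
  have hall : ∀ᶠ u in 𝓝 t, (|u - t| < ε ∧ F u (θ₀ - δ) < 0 ∧ 0 < F u (θ₀ + δ)) ∧
      ∀ θ, ContinuousAt (fun p : ℝ × ℝ => F p.1 p.2) (u, θ) :=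
    (hnear.and (hneg.and hps)).and hF
  have hex : ∀ u, (|u - t| < ε ∧ F u (θ₀ - δ) < 0 ∧ 0 < F u (θ₀ + δ)) →
      ∃ x ∈ Set.Ioo (θ₀ - δ) (θ₀ + δ), F u x = 0 := by
    rintro u ⟨-, hu1, hu2⟩
    have := intermediate_value_Ioo (f := F u) (show θ₀ - δ ≤ θ₀ + δ by linarith)
      (fun x _ => (hD u x).continuousAt.continuousWithinAt)
    obtain ⟨x, hx, hx0⟩ := this (show (0 : ℝ) ∈ Set.Ioo _ _ from ⟨hu1, hu2⟩)
    exact ⟨x, hx, hx0⟩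
  classical
  -- The default `0` is taken only where the sign conditions fail, which does not happen near `t`.
  let θ : ℝ → ℝ := fun u => if h : (|u - t| < ε ∧ F u (θ₀ - δ) < 0 ∧ 0 < F u (θ₀ + δ)) then
    (hex u h).choose else 0
  have hθ : ∀ u, (|u - t| < ε ∧ F u (θ₀ - δ) < 0 ∧ 0 < F u (θ₀ + δ)) →
      θ u ∈ Set.Ioo (θ₀ - δ) (θ₀ + δ) ∧ F u (θ u) = 0 := by
    intro u hu
    simp only [θ, dif_pos hu]
    exact (hex u hu).choose_spec
  refine ⟨θ, ?_, ?_, ?_⟩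
  · filter_upwards [hall.eventually_nhds] with u hu
    obtain ⟨hu1, hu2⟩ := hu.self_of_nhds
    obtain ⟨hmem, hroot⟩ := hθ u hu1
    have hmu := hmono u hu1.1
    -- The sign of `F u x` persists for `v` near `u`, and monotonicity of `F v` then keeps `θ v` on
    -- the same side of `x`.
    have hlt : ∀ x ∈ Set.Ioo (θ₀ - δ) (θ₀ + δ), x < θ u → ∀ᶠ v in 𝓝 u, x < θ v := by
      intro x hx hlt
      have h2 : F u x < 0 := by
        rw [← hroot]
        exact hmu ⟨hx.1.le, hx.2.le⟩ ⟨hmem.1.le, hmem.2.le⟩ hlt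
      have h3 : ContinuousAt (fun v => F v x) u :=
        (hu2 x).comp (f := fun v : ℝ => (v, x)) (by fun_prop)
      filter_upwards [hu, h3.eventually (gt_mem_nhds h2)] with v hv hv2
      obtain ⟨hmemv, hrootv⟩ := hθ v hv.1
      by_contra hle
      have := (hmono v hv.1.1).monotoneOn ⟨hmemv.1.le, hmemv.2.le⟩ ⟨hx.1.le, hx.2.le⟩
        (not_lt.mp hle)
      linarith
    have hgt : ∀ x ∈ Set.Ioo (θ₀ - δ) (θ₀ + δ), θ u < x → ∀ᶠ v in 𝓝 u, θ v < x := by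
      intro x hx hlt
      have h2 : 0 < F u x := by
        rw [← hroot]
        exact hmu ⟨hmem.1.le, hmem.2.le⟩ ⟨hx.1.le, hx.2.le⟩ hlt
      have h3 : ContinuousAt (fun v => F v x) u :=
        (hu2 x).comp (f := fun v : ℝ => (v, x)) (by fun_prop)
      filter_upwards [hu, h3.eventually (lt_mem_nhds h2)] with v hv hv2
      obtain ⟨hmemv, hrootv⟩ := hθ v hv.1
      by_contra hle
      have := (hmono v hv.1.1).monotoneOn ⟨hx.1.le, hx.2.le⟩ ⟨hmemv.1.le, hmemv.2.le⟩
        (not_lt.mp hle)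
      linarith
    refine tendsto_order.mpr ⟨fun a ha => ?_, fun a ha => ?_⟩
    · obtain ⟨x, hx1, hx2⟩ := exists_between (max_lt ha hmem.1)
      filter_upwards [hlt x ⟨(le_max_right _ _).trans_lt hx1, hx2.trans hmem.2⟩ hx2] with v hv
      exact (le_max_left _ _).trans_lt (hx1.trans hv)
    · obtain ⟨x, hx1, hx2⟩ := exists_between (lt_min ha hmem.2)
      filter_upwards [hgt x ⟨hmem.1.trans hx1, hx2.trans_le (min_le_right _ _)⟩ hx1] with v hv
      exact hv.trans (hx2.trans_le (min_le_left _ _))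
  · filter_upwards [hall] with u hu
    exact (hθ u hu.1).2
  · obtain ⟨hmem, hroot⟩ := hθ t hall.self_of_nhds.1
    exact hm0.injOn ⟨hmem.1.le, hmem.2.le⟩ ⟨by linarith, by linarith⟩ (hroot.trans h0.symm)

/-- The rotated value `e^{-i j θ / 2} p_j(e^{iθ})`. -/
def rotatedPoly (n : ℕ) (α : ℕ → ℂ) (τ ζ s : ℂ) (p₀ : ℝ) (j : ℕ) (θ : ℝ) : ℂ :=
  Complex.exp (-(j * (θ / 2) * Complex.I)) *
    (poly n α τ ζ s p₀ j).eval (Complex.exp (θ * Complex.I))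

/-- With `y = e^{-iθ/2}` the rotated values satisfy a three-term recurrence with real coefficients
`2 Re (β_j y)` and `-1`, starting from the real `p₀`. -/
theorem rotatedPoly_real (n : ℕ) (α : ℕ → ℂ) (τ ζ s : ℂ) (p₀ : ℝ) (j : ℕ) (θ : ℝ) :
    conj (rotatedPoly n α τ ζ s p₀ j θ) = rotatedPoly n α τ ζ s p₀ j θ := by
  set y := Complex.exp (-(θ / 2 * Complex.I)) with hy
  have hyc : conj y = Complex.exp (θ / 2 * Complex.I) := by
    rw [hy, ← Complex.exp_conj]
    simp [Complex.conj_ofNat]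
  have hyy : conj y * y = 1 := by
    rw [hyc, hy, ← Complex.exp_add]; simp
  have hz : Complex.exp (θ * Complex.I) = conj y ^ 2 := by
    rw [hyc, ← Complex.exp_nat_mul]; congr 1; push_cast; ring
  have hr : ∀ j, rotatedPoly n α τ ζ s p₀ j θ =
      y ^ j * (poly n α τ ζ s p₀ j).eval (conj y ^ 2) := by
    intro j
    rw [rotatedPoly, hz, hy, ← Complex.exp_nat_mul]
    congr 2; ring
  have hrec : ∀ j, rotatedPoly n α τ ζ s p₀ (j + 1) θ =
      (beta n α τ ζ s j * y + conj (beta n α τ ζ s j) * conj y) * rotatedPoly n α τ ζ s p₀ j θ -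
        if 0 < j then rotatedPoly n α τ ζ s p₀ (j - 1) θ else 0 := by
    intro j
    simp only [hr, eval_poly_succ]
    rcases j with _ | j
    · simp
      linear_combination (conj (beta n α τ ζ s 0) * conj y *
        (poly n α τ ζ s p₀ 0).eval (conj y ^ 2)) * hyy
    · simp only [Nat.succ_pos, if_true, Nat.add_sub_cancel]
      linear_combination (conj (beta n α τ ζ s (j + 1)) * conj y * y ^ (j + 1) *
        (poly n α τ ζ s p₀ (j + 1)).eval (conj y ^ 2)) * hyy -
        (y ^ j * (poly n α τ ζ s p₀ j).eval (conj y ^ 2)) * (conj y * y + 1) * hyy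
  induction j using Nat.strong_induction_on with
  | _ j ih =>
    rcases j with _ | j
    · simp [rotatedPoly, poly]
    · have h1 : conj (if 0 < j then rotatedPoly n α τ ζ s p₀ (j - 1) θ else 0) =
          if 0 < j then rotatedPoly n α τ ζ s p₀ (j - 1) θ else 0 := by
        split_ifs
        · exact ih _ (by omega)
        · simp
      rw [hrec, map_sub, map_mul, ih j (by omega), h1, map_add, map_mul, map_mul, Complex.conj_conj,
        Complex.conj_conj, add_comm (conj _ * _)]

/-- The derivative of `rotatedPoly` with respect to the angle. -/
def rotatedPolyDeriv (n : ℕ) (α : ℕ → ℂ) (τ ζ s : ℂ) (p₀ : ℝ) (j : ℕ) (θ : ℝ) : ℂ :=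
  Complex.exp (-(j * (θ / 2) * Complex.I)) * (Complex.I *
    ((Polynomial.derivative (poly n α τ ζ s p₀ j)).eval (Complex.exp (θ * Complex.I)) *
      Complex.exp (θ * Complex.I) -
      j / 2 * (poly n α τ ζ s p₀ j).eval (Complex.exp (θ * Complex.I))))

theorem hasDerivAt_rotatedPoly (n : ℕ) (α : ℕ → ℂ) (τ ζ s : ℂ) (p₀ : ℝ) (j : ℕ) (θ : ℝ) :
    HasDerivAt (rotatedPoly n α τ ζ s p₀ j) (rotatedPolyDeriv n α τ ζ s p₀ j θ) θ := by
  have h0 : HasDerivAt (fun x : ℝ => (x : ℂ)) 1 θ := Complex.ofRealCLM.hasDerivAt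
  have h1 : HasDerivAt (fun x : ℝ => Complex.exp (x * Complex.I))
      (Complex.exp (θ * Complex.I) * (1 * Complex.I)) θ := (h0.mul_const _).cexp
  have h2 : HasDerivAt (fun x : ℝ => Complex.exp (-(j * (x / 2) * Complex.I)))
      (Complex.exp (-(j * (θ / 2) * Complex.I)) * -(j * (1 / 2) * Complex.I)) θ :=
    (((h0.div_const 2).const_mul (j : ℂ)).mul_const Complex.I).neg.cexp
  have h3 := ((poly n α τ ζ s p₀ j).hasDerivAt (Complex.exp (θ * Complex.I))).comp θ h1
  refine (h2.mul h3).congr_deriv ?_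
  simp only [rotatedPolyDeriv, Function.comp_apply]
  ring

theorem hasDerivAt_re_rotatedPoly (n : ℕ) (α : ℕ → ℂ) (τ ζ s : ℂ) (p₀ : ℝ) (j : ℕ) (θ : ℝ) :
    HasDerivAt (fun x => (rotatedPoly n α τ ζ s p₀ j x).re)
      (rotatedPolyDeriv n α τ ζ s p₀ j θ).re θ :=
  Complex.reCLM.hasFDerivAt.comp_hasDerivAt θ (hasDerivAt_rotatedPoly n α τ ζ s p₀ j θ)

theorem im_rotatedPolyDeriv (n : ℕ) (α : ℕ → ℂ) (τ ζ s : ℂ) (p₀ : ℝ) (j : ℕ) (θ : ℝ) :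
    (rotatedPolyDeriv n α τ ζ s p₀ j θ).im = 0 := by
  have h1 : HasDerivAt (fun x => (rotatedPoly n α τ ζ s p₀ j x).im)
      (rotatedPolyDeriv n α τ ζ s p₀ j θ).im θ :=
    Complex.imCLM.hasFDerivAt.comp_hasDerivAt θ (hasDerivAt_rotatedPoly n α τ ζ s p₀ j θ)
  have h2 : (fun x => (rotatedPoly n α τ ζ s p₀ j x).im) = fun _ => 0 :=
    funext fun x => Complex.conj_eq_iff_im.mp (rotatedPoly_real n α τ ζ s p₀ j x)
  rw [h2] at h1
  exact h1.unique (hasDerivAt_const _ _)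

theorem re_rotatedPoly_eq_zero_iff {n : ℕ} {α : ℕ → ℂ} {τ ζ s : ℂ} {p₀ : ℝ} {j : ℕ} {θ : ℝ} :
    (rotatedPoly n α τ ζ s p₀ j θ).re = 0 ↔
      (poly n α τ ζ s p₀ j).IsRoot (Complex.exp (θ * Complex.I)) := by
  have h1 := Complex.conj_eq_iff_re.mp (rotatedPoly_real n α τ ζ s p₀ j θ)
  rw [← Complex.ofReal_eq_zero, h1, rotatedPoly, mul_eq_zero,
    or_iff_right (Complex.exp_ne_zero _), Polynomial.IsRoot.def]

theorem continuousAt_mulVec {m : ℕ} {M : ℝ → Matrix (Fin m) (Fin m) ℂ} {v : ℝ → Fin m → ℂ} {t : ℝ}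
    (hM : ∀ i j, ContinuousAt (fun u => M u i j) t) (hv : ∀ j, ContinuousAt (fun u => v u j) t) :
    ContinuousAt (fun u => (M u).mulVec (v u)) t := by
  refine continuousAt_pi.mpr fun i => ?_
  simp only [Matrix.mulVec, dotProduct]
  exact tendsto_finsetSum _ fun j _ => (hM i j).mul (hv j)

/-! ### The flow in time and the derivative formula. -/

/-- The hypotheses on the time-dependent matrix at the time `t`: it is differentiable, and `ζ` is
not an eigenvalue. -/
structure Flow (n : ℕ) (α : ℝ → ℕ → ℂ) (τ : ℝ → ℂ) (ζ s : ℂ) (t : ℝ) : Prop where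
  params : ∀ u, Params n (α u) (τ u) ζ s
  differentiable : ∀ i j, Differentiable ℝ fun u => G n (α u) (τ u) i j
  not_isEigenvalue : ¬ IsEigenvalue (G n (α t) (τ t)) ζ

namespace Flow

variable {n : ℕ} {α : ℝ → ℕ → ℂ} {τ : ℝ → ℂ} {ζ s : ℂ} {t : ℝ} {p₀ : ℝ}

theorem differentiableAt_coeff (h : Flow n α τ ζ s t) (u : ℝ) {j : ℕ} (hj : j < n) :
    DifferentiableAt ℝ (fun u => α u j) u := by
  have := Hessenberg.differentiableAt_coeff (h.params u).norm_coeff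
    (fun i j => h.differentiable i j u) hj.le
  simpa [hj] using this

theorem differentiableAt_last (h : Flow n α τ ζ s t) (u : ℝ) : DifferentiableAt ℝ τ u := by
  have := Hessenberg.differentiableAt_coeff (h.params u).norm_coeff
    (fun i j => h.differentiable i j u) le_rfl
  simpa using this

/-- Continuity of `τ_0` makes the condition open, so the pointwise results hold for all times near
`t`. -/
theorem eventually_ne_one (h : Flow n α τ ζ s t) :
    ∀ᶠ u in 𝓝 t, pseudo n (α u) (τ u) ζ 0 * ζ ≠ 1 := by
  have h1 := (differentiableAt_pseudo (h.params t) (fun _ => h.differentiableAt_coeff t)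
    (h.differentiableAt_last t) 0).continuousAt
  exact (h1.mul continuousAt_const).eventually_ne fun h2 =>
    h.not_isEigenvalue ((h.params t).isEigenvalue_base h2)

theorem ne_one (h : Flow n α τ ζ s t) : pseudo n (α t) (τ t) ζ 0 * ζ ≠ 1 :=
  h.eventually_ne_one.self_of_nhds

theorem differentiableAt_beta (h : Flow n α τ ζ s t) {u : ℝ}
    (hu : pseudo n (α u) (τ u) ζ 0 * ζ ≠ 1) {j : ℕ} (hj : j ≤ n) :
    DifferentiableAt ℝ (fun u => beta n (α u) (τ u) ζ s j) u :=
  Hessenberg.differentiableAt_beta (h.params u) hu (fun _ => h.differentiableAt_coeff u)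
    (h.differentiableAt_last u) hj

theorem eventually_posDef (h : Flow n α τ ζ s t) :
    ∀ᶠ u in 𝓝 t, (H n (α u) (τ u) ζ s).PosDef := by
  filter_upwards [h.eventually_ne_one] with u hu
  exact (h.params u).H_posDef hu

theorem differentiableAt_cayley (h : Flow n α τ ζ s t) (i j : Fin (n + 1)) :
    DifferentiableAt ℝ (fun u => cayley n (α u) (τ u) ζ s i j) t :=
  Hessenberg.differentiableAt_cayley (fun _ => h.differentiableAt_beta h.ne_one)
    h.eventually_posDef i j

theorem exists_isArgBranch (h : Flow n α τ ζ s t) {η : ℂ}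
    (hη : IsEigenvalue (G n (α t) (τ t)) η) :
    ∃ θ : ℝ → ℝ, IsArgBranch (fun u => G n (α u) (τ u)) t η θ := by
  have hroot := ((h.params t).isEigenvalue_iff h.ne_one one_ne_zero η).mp hη
  have hnorm := (h.params t).norm_eq_one_of_isRoot_poly h.ne_one one_ne_zero hroot
  have hexp : Complex.exp (Complex.arg η * Complex.I) = η := by
    have := Complex.norm_mul_exp_arg_mul_I η
    rwa [hnorm, Complex.ofReal_one, one_mul] at this
  let F : ℝ → ℝ → ℝ := fun u θ => (rotatedPoly n (α u) (τ u) ζ s 1 (n + 1) θ).re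
  let D : ℝ → ℝ → ℝ := fun u θ => (rotatedPolyDeriv n (α u) (τ u) ζ s 1 (n + 1) θ).re
  have hβ : ∀ u, pseudo n (α u) (τ u) ζ 0 * ζ ≠ 1 → ∀ θ : ℝ, ∀ j ≤ n,
      ContinuousAt (fun p : ℝ × ℝ => beta n (α p.1) (τ p.1) ζ s j) (u, θ) := by
    intro u hu θ j hj
    exact ContinuousAt.comp (f := Prod.fst) (x := (u, θ))
      (h.differentiableAt_beta hu hj).continuousAt continuousAt_fst
  have hz : Continuous fun p : ℝ × ℝ => Complex.exp (p.2 * Complex.I) := by fun_prop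
  have hy : Continuous fun p : ℝ × ℝ =>
      Complex.exp (-(((n + 1 : ℕ) : ℂ) * (p.2 / 2) * Complex.I)) := by fun_prop
  have hF : ∀ᶠ u in 𝓝 t, ∀ θ, ContinuousAt (fun p : ℝ × ℝ => F p.1 p.2) (u, θ) := by
    filter_upwards [h.eventually_ne_one] with u hu θ
    exact Complex.continuous_re.continuousAt.comp (hy.continuousAt.mul
      (continuousAt_eval_poly (hβ u hu θ) hz.continuousAt 1 le_rfl))
  have hDc : ContinuousAt (fun p : ℝ × ℝ => D p.1 p.2) (t, Complex.arg η) :=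
    Complex.continuous_re.continuousAt.comp (hy.continuousAt.mul (continuousAt_const.mul
      (((continuousAt_eval_derivative_poly (hβ t h.ne_one _) hz.continuousAt 1 le_rfl).mul
        hz.continuousAt).sub (continuousAt_const.mul
      (continuousAt_eval_poly (hβ t h.ne_one _) hz.continuousAt 1 le_rfl)))))
  have hD : ∀ u θ, HasDerivAt (F u) (D u θ) θ := fun u θ => hasDerivAt_re_rotatedPoly ..
  have h0 : F t (Complex.arg η) = 0 := by
    rw [← hexp] at hroot
    exact re_rotatedPoly_eq_zero_iff.mpr hroot
  -- At a zero the derivative in the angle is a nonzero multiple of `η p_{n+1}'(η)`, and it is real,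
  -- so its real part cannot vanish.
  have hne : D t (Complex.arg η) ≠ 0 := by
    intro hD0
    have h1 : rotatedPolyDeriv n (α t) (τ t) ζ s 1 (n + 1) (Complex.arg η) = 0 :=
      Complex.ext hD0 (im_rotatedPolyDeriv ..)
    rw [rotatedPolyDeriv, hexp, hroot.eq_zero, mul_zero, sub_zero] at h1
    have h2 := (h.params t).derivative_ne_zero_of_isRoot_poly h.ne_one one_ne_zero hroot
    have h3 : η ≠ 0 := norm_ne_zero_iff.mp (by rw [hnorm]; exact one_ne_zero)
    exact mul_ne_zero (Complex.exp_ne_zero _) (mul_ne_zero Complex.I_ne_zero (mul_ne_zero h2 h3)) h1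
  have hbranch : ∃ θ : ℝ → ℝ, (∀ᶠ u in 𝓝 t, ContinuousAt θ u) ∧
      (∀ᶠ u in 𝓝 t, F u (θ u) = 0) ∧ θ t = Complex.arg η := by
    -- If the derivative is negative, `-F` has the same zeros and an increasing profile.
    rcases hne.lt_or_gt with hlt | hgt
    · obtain ⟨θ, h1, h2, h3⟩ := exists_continuous_root (F := fun u θ => -F u θ)
        (D := fun u θ => -D u θ) (t := t) (θ₀ := Complex.arg η)
        (hF.mono fun u hu θ => (hu θ).neg) (fun u θ => (hD u θ).neg) hDc.neg (by simp [h0])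
        (by simpa using hlt)
      exact ⟨θ, h1, h2.mono fun u hu => neg_eq_zero.mp hu, h3⟩
    · exact exists_continuous_root hF hD hDc h0 hgt
  obtain ⟨θ, h1, h2, h3⟩ := hbranch
  refine ⟨θ, h1, ?_, by rw [h3, hexp]⟩
  filter_upwards [h2, h.eventually_ne_one] with u hu hu'
  exact ((h.params u).isEigenvalue_iff hu' one_ne_zero _).mpr (re_rotatedPoly_eq_zero_iff.mp hu)

/-- Apply `hasDerivAt_eigenvalue` to the eigenvector `x = H^{1/2} p`, with `p` taken at the moving
eigenvalue; moving `H^{1/2}` across the inner product gives `(x, x) = (p, H p)`. -/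
theorem hasDerivAt_eigenvalue_cayley (h : Flow n α τ ζ s t) (hp : p₀ ≠ 0) {η : ℂ} {θ : ℝ → ℝ}
    (hθ : IsArgBranch (fun u => G n (α u) (τ u)) t η θ) :
    HasDerivAt (fun u => cayleyValue (conj ζ * Complex.exp (θ u * Complex.I)))
      (quadForm (rootH n (α t) (τ t) ζ s * matrixDeriv (fun u => cayley n (α u) (τ u) ζ s) t *
          rootH n (α t) (τ t) ζ s) (polyVec n (α t) (τ t) ζ s p₀ η) /
        quadForm (H n (α t) (τ t) ζ s) (polyVec n (α t) (τ t) ζ s p₀ η)) t := by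
  obtain ⟨hc, hev, rfl⟩ := hθ
  have hP := h.params t
  have hpd := hP.H_posDef h.ne_one
  have hR := rootH_posDef hpd
  let x : ℝ → Fin (n + 1) → ℂ := fun u =>
    (rootH n (α u) (τ u) ζ s).mulVec (polyVec n (α u) (τ u) ζ s p₀ (Complex.exp (θ u * Complex.I)))
  have hβ : ∀ j ≤ n, DifferentiableAt ℝ (fun u => beta n (α u) (τ u) ζ s j) t :=
    fun _ => h.differentiableAt_beta h.ne_one
  have hz : ContinuousAt (fun u => Complex.exp (θ u * Complex.I)) t := by
    have h1 : Continuous fun y : ℝ => Complex.exp (y * Complex.I) := by fun_prop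
    exact h1.continuousAt.comp hc.self_of_nhds
  have hx : ContinuousAt x t := by
    refine continuousAt_mulVec
      (fun i j => (differentiableAt_rootH_apply hβ h.eventually_posDef i j).continuousAt)
      fun j => ?_
    exact continuousAt_eval_poly (fun j hj => (hβ j hj).continuousAt) hz p₀ (by omega)
  have hroot : ∀ᶠ u in 𝓝 t, (poly n (α u) (τ u) ζ s p₀ (n + 1)).IsRoot
      (Complex.exp (θ u * Complex.I)) := by
    filter_upwards [hev, h.eventually_ne_one] with u hu hu'
    exact ((h.params u).isEigenvalue_iff hu' hp _).mp hu
  have hx0 : x t ≠ 0 := by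
    intro h1
    refine Params.polyVec_ne_zero (n := n) (α := α t) (τ := τ t) (ζ := ζ) (s := s) hp
      (Complex.exp (θ t * Complex.I)) ?_
    exact Matrix.mulVec_injective_of_isUnit hR.isUnit (h1.trans (Matrix.mulVec_zero _).symm)
  have hw1 := hP.ne_one_of_isRoot h.ne_one hp hroot.self_of_nhds
  have hw : ‖conj ζ * Complex.exp (θ t * Complex.I)‖ = 1 := by
    rw [norm_mul, Complex.norm_conj, hP.norm_base, Complex.norm_exp_ofReal_mul_I, one_mul]
  have key := hasDerivAt_eigenvalue
    (C' := matrixDeriv (fun u => cayley n (α u) (τ u) ζ s) t) (x := x)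
    (lam := fun u => cayleyValue (conj ζ * Complex.exp (θ u * Complex.I)))
    (fun i j => (h.differentiableAt_cayley i j).hasDerivAt) (hP.cayley_isHermitian h.ne_one) hx hx0
    (by
      filter_upwards [hroot, h.eventually_ne_one] with u hu hu'
      exact (h.params u).cayley_mulVec hu' hp hu)
    (conj_cayleyValue hw hw1)
  have hstar : ∀ y, star (x t) ⬝ᵥ y = star (polyVec n (α t) (τ t) ζ s p₀
      (Complex.exp (θ t * Complex.I))) ⬝ᵥ (rootH n (α t) (τ t) ζ s).mulVec y := by
    intro y
    simp only [x]
    rw [Matrix.star_mulVec, hR.isHermitian.eq, ← Matrix.dotProduct_mulVec]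
  rw [hstar, hstar] at key
  simp only [x, Matrix.mulVec_mulVec, rootH_mul_self hpd] at key
  rw [quadForm, quadForm, Matrix.mul_assoc]
  exact key

theorem argument_derivative (h : Flow n α τ ζ s t) (hp : p₀ ≠ 0) {η : ℂ} {θ : ℝ → ℝ}
    (hθ : IsArgBranch (fun u => G n (α u) (τ u)) t η θ) :
    DifferentiableAt ℝ θ t ∧
      quadForm (rootH n (α t) (τ t) ζ s * matrixDeriv (fun u => cayley n (α u) (τ u) ζ s) t *
          rootH n (α t) (τ t) ζ s) (polyVec n (α t) (τ t) ζ s p₀ η) =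
        quadForm (H n (α t) (τ t) ζ s) (polyVec n (α t) (τ t) ζ s p₀ η) /
          ((Real.cos (Complex.arg (conj ζ * η)) - 1 : ℝ) : ℂ) * ((deriv θ t : ℝ) : ℂ) := by
  have hlam := h.hasDerivAt_eigenvalue_cayley hp hθ
  obtain ⟨hc, hev, rfl⟩ := hθ
  have hP := h.params t
  have hw1 : ∀ᶠ u in 𝓝 t, conj ζ * Complex.exp (θ u * Complex.I) ≠ 1 := by
    filter_upwards [hev, h.eventually_ne_one] with u hu hu'
    exact (h.params u).ne_one_of_isRoot hu' hp (((h.params u).isEigenvalue_iff hu' hp _).mp hu)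
  have hw : ‖conj ζ * Complex.exp (θ t * Complex.I)‖ = 1 := by
    rw [norm_mul, Complex.norm_conj, hP.norm_base, Complex.norm_exp_ofReal_mul_I, one_mul]
  have hdiff : DifferentiableAt ℝ θ t := by
    -- Differentiability of `θ` comes from that of the Cayley eigenvalue, by inverting the Cayley
    -- map.
    refine differentiableAt_argument (f := fun u => ζ *
      ((cayleyValue (conj ζ * Complex.exp (θ u * Complex.I)) + Complex.I) /
      (cayleyValue (conj ζ * Complex.exp (θ u * Complex.I)) - Complex.I))) hc.self_of_nhds ?_ ?_
    · exact ((hlam.differentiableAt.add_const _).div (hlam.differentiableAt.sub_const _)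
        (inv_cayleyValue hw1.self_of_nhds).1).const_mul _
    · filter_upwards [hw1] with u hu
      rw [← (inv_cayleyValue hu).2]
      linear_combination (-Complex.exp (θ u * Complex.I)) * hP.conj_base_mul
  refine ⟨hdiff, ?_⟩
  have hwd : HasDerivAt (fun u => conj ζ * Complex.exp (θ u * Complex.I))
      (conj ζ * Complex.exp (θ t * Complex.I) * ((deriv θ t : ℝ) * Complex.I)) t := by
    have h1 := ((hdiff.hasDerivAt.ofReal_comp.mul_const Complex.I).cexp).const_mul (conj ζ)
    refine h1.congr_deriv ?_
    ring
  -- Two expressions for the velocity of one Cayley eigenvalue: by perturbation of the matrix and by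
  -- motion of `w` on the circle.
  have h2 := hlam.unique (hasDerivAt_cayleyValue hw hw1.self_of_nhds hwd)
  have h3 : quadForm (H n (α t) (τ t) ζ s)
      (polyVec n (α t) (τ t) ζ s p₀ (Complex.exp (θ t * Complex.I))) ≠ 0 :=
    ((hP.H_posDef h.ne_one).dotProduct_mulVec_pos (Params.polyVec_ne_zero hp _)).ne'
  rw [div_eq_iff h3] at h2
  rw [h2, cos_arg_of_norm_one hw]
  ring

end Flow
end Hessenberg

end

theorem mainTheorem1 (n : ℕ) (α : ℝ → ℕ → ℂ) (τ : ℝ → ℂ)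
    (hα : ∀ t, ∀ j < n, ‖α t j‖ < 1) (hτ : ∀ t, ‖τ t‖ = 1)
    (hG : ∀ i j, Differentiable ℝ fun t => Hessenberg.G n (α t) (τ t) i j)
    (ζ s : ℂ) (hζ : ‖ζ‖ = 1) (hs : s ^ 2 = ζ) (p₀ : ℝ) (hp₀ : p₀ ≠ 0)
    (t : ℝ) (ht : ¬ Hessenberg.IsEigenvalue (Hessenberg.G n (α t) (τ t)) ζ) :
    (Hessenberg.H n (α t) (τ t) ζ s).PosDef ∧
    (∀ z : ℂ, Hessenberg.IsEigenvalue (Hessenberg.G n (α t) (τ t)) z ↔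
      (Hessenberg.poly n (α t) (τ t) ζ s p₀ (n + 1)).IsRoot z) ∧
    (Hessenberg.poly n (α t) (τ t) ζ s p₀ (n + 1)).roots =
      (Hessenberg.G n (α t) (τ t)).charpoly.roots ∧
    (∀ i j, DifferentiableAt ℝ (fun u => Hessenberg.cayley n (α u) (τ u) ζ s i j) t) ∧
    ∀ η : ℂ, Hessenberg.IsEigenvalue (Hessenberg.G n (α t) (τ t)) η →
      (∃ θ : ℝ → ℝ, Hessenberg.IsArgBranch (fun u => Hessenberg.G n (α u) (τ u)) t η θ) ∧
      ∀ θ : ℝ → ℝ, Hessenberg.IsArgBranch (fun u => Hessenberg.G n (α u) (τ u)) t η θ →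
        DifferentiableAt ℝ θ t ∧
        Hessenberg.quadForm
            (Hessenberg.rootH n (α t) (τ t) ζ s
              * Hessenberg.matrixDeriv (fun u => Hessenberg.cayley n (α u) (τ u) ζ s) t
              * Hessenberg.rootH n (α t) (τ t) ζ s)
            (Hessenberg.polyVec n (α t) (τ t) ζ s p₀ η) =
          Hessenberg.quadForm (Hessenberg.H n (α t) (τ t) ζ s)
              (Hessenberg.polyVec n (α t) (τ t) ζ s p₀ η)
            / ((Real.cos (Complex.arg (conj ζ * η)) - 1 : ℝ) : ℂ)
            * ((deriv θ t : ℝ) : ℂ) := by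
  have h : Hessenberg.Flow n α τ ζ s t :=
    { params := fun u => ⟨hα u, hτ u, hζ, hs⟩
      differentiable := hG
      not_isEigenvalue := ht }
  have hP := h.params t
  exact ⟨hP.H_posDef h.ne_one, hP.isEigenvalue_iff h.ne_one hp₀, hP.roots_poly_eq h.ne_one hp₀,
    h.differentiableAt_cayley, fun η hη => ⟨h.exists_isArgBranch hη,
      fun θ hθ => h.argument_derivative hp₀ hθ⟩⟩
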